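/- Let $\Omega\subset\mathbb{C}=\mathbb{R}^2$ be a simply connected domain with non-empty boundary, let $\varphi:\Omega\to\mathbb{D}$ be a conformal homeomorphism onto the open unit disc, with inverse $\varphi^{-1}:\mathbb{D}\to\Omega$, and let $h(z)=J_\varphi(z)=|\varphi'(z)|^2$ be its conformal weight. Let $\alpha_0\in(-2,0)$ and assume that the (inverse) Brennan conjecture holds on $[\alpha_0,2/3)$, that is, $\iint_{\mathbb{D}}|\psi'(u,v)|^{\alpha}\,du\,dv<\infty$ for every $\alpha\in[\alpha_0,2/3)$ and every conformal homeomorphism $\psi$ of $\mathbb{D}$ onto a planar domain. Let $$p\in\Big(\frac{|\alpha_0|+2}{|\alpha_0|+1},\,2\Big),\qquad 1\le r\le \frac{2p}{2-p}\cdot\frac{|\alpha_0|}{2+|\alpha_0|}.$$ For a domain $U\subset\mathbb{R}^2$ let $L^{1,s}(U)$ be the space of locally integrable, weakly differentiable functions $f:U\to\mathbb{R}$ with $\nabla f\in L^s(U)$, seminormed by $\|\nabla f\|_{L^s(U)}$, and let $W^{1,s}(U)=L^s(U)\cap L^{1,s}(U)$. Let $B_{r,p}(\Omega,h)\in[0,\infty]$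 be the best constant in the weighted Poincaré–Sobolev inequality $$\inf_{c\in\mathbb{R}}\Big(\iint_\Omega |f-c|^r h\,dx\,dy\Big)^{1/r}\le B_{r,p}(\Omega,h)\Big(\iint_\Omega|\nabla f|^p\,dx\,dy\Big)^{1/p},\qquad f\in W^{1,p}(\Omega),$$ let $B_{r,q}(\mathbb{D})\in[0,\infty]$ be the best constant in the corresponding non-weighted $(r,q)$-inequality on $\mathbb{D}$ for functions of $W^{1,q}(\mathbb{D})$, and let $K_{p,q}\in[0,\infty]$ be the norm of the composition operator $L^{1,p}(\Omega)\to L^{1,q}(\mathbb{D})$, $f\mapsto f\circ\varphi^{-1}$ (a best constant or norm is $\infty$ when no finite constant works). Then $B_{r,p}(\Omega,h)$ is finite, the weighted inequality above holds for every $f\in W^{1,p}(\Omega)$, and $$B_{r,p}(\Omega,h)\le \inf_{q\in[1,\,2p/(4-p))} K_{p,q}\cdot B_{r,q}(\mathbb{D})<\infty ,$$ where for every $q\in[1,2p/(4-p))$ $$K_{p,q}\le\Big(\iint_{\mathbb{D}}|(\varphi^{-1})'(u,v)|^{\frac{(p-2)q}{p-q}}\,du\,dv\Big)^{\frac{p-q}{pq}},$$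 the right-hand side being possibly infinite. -/

import Mathlib

open Set MeasureTheory
open scoped ENNReal ContDiff

/-- `G : ℂ → ℂ` is a weak gradient on the open set `Ω ⊆ ℂ = ℝ²` of the real function `f`
(the gradient vector `(∂ₓf, ∂ᵧf)` is written as the complex number `∂ₓf + i ∂ᵧf`, so that
`inner ℝ (G z) v` is the derivative in the direction `v` and `‖G z‖` is its Euclidean length). -/
def HasWeakGradientOn (Ω : Set ℂ) (f : ℂ → ℝ) (G : ℂ → ℂ) : Prop :=
  LocallyIntegrableOn f Ω ∧ LocallyIntegrableOn G Ω ∧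
    ∀ η : ℂ → ℝ, ContDiff ℝ ∞ η → HasCompactSupport η → tsupport η ⊆ Ω → ∀ v : ℂ,
      ∫ z in Ω, f z * fderiv ℝ η z v = - ∫ z in Ω, inner ℝ (G z) v * η z

/-- `f` belongs to the homogeneous Sobolev space `L^{1,p}(Ω)`, and `G` is its weak gradient. -/
def MemHomSobolev (p : ℝ) (Ω : Set ℂ) (f : ℂ → ℝ) (G : ℂ → ℂ) : Prop :=
  HasWeakGradientOn Ω f G ∧ MemLp G (ENNReal.ofReal p) (volume.restrict Ω)

/-- `f` belongs to the Sobolev space `W^{1,p}(Ω)`, and `G` is its weak gradient. -/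
def MemSobolev (p : ℝ) (Ω : Set ℂ) (f : ℂ → ℝ) (G : ℂ → ℂ) : Prop :=
  MemLp f (ENNReal.ofReal p) (volume.restrict Ω) ∧ MemHomSobolev p Ω f G

/-- The norm `‖G | L^p(Ω)‖ = (∫_Ω |G|^p)^{1/p}` of a vector field, with values in `[0, ∞]`. -/
noncomputable def gradNorm (p : ℝ) (Ω : Set ℂ) (G : ℂ → ℂ) : ℝ≥0∞ :=
  (∫⁻ z in Ω, ‖G z‖ₑ ^ p) ^ (1 / p)

/-- `inf_{c ∈ ℝ} (∫_Ω |f - c|^r h)^{1/r}`, with values in `[0, ∞]`. -/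
noncomputable def infDistConst (r : ℝ) (Ω : Set ℂ) (h : ℂ → ℝ) (f : ℂ → ℝ) : ℝ≥0∞ :=
  ⨅ c : ℝ, (∫⁻ z in Ω, ‖f z - c‖ₑ ^ r * ENNReal.ofReal (h z)) ^ (1 / r)

/-- The best constant `B_{r,p}(Ω, h) ∈ [0, ∞]` in the `(r, p)`-Poincaré–Sobolev inequality
on `Ω` with weight `h` (it is `∞` if the inequality holds with no finite constant). -/
noncomputable def poincareConst (r p : ℝ) (Ω : Set ℂ) (h : ℂ → ℝ) : ℝ≥0∞ :=
  sInf {C : ℝ≥0∞ | ∀ (f : ℂ → ℝ) (G : ℂ → ℂ), MemSobolev p Ω f G →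
    infDistConst r Ω h f ≤ C * gradNorm p Ω G}

/-- The norm in `[0, ∞]` of the composition operator `ψ^* : L^{1,p}(Ω) → L^{1,q}(Ω')`,
`f ↦ f ∘ ψ`, induced by `ψ : Ω' → Ω` (it is `∞` if `ψ` induces no bounded operator). -/
noncomputable def compositionNorm (p q : ℝ) (Ω Ω' : Set ℂ) (ψ : ℂ → ℂ) : ℝ≥0∞ :=
  sInf {K : ℝ≥0∞ | K < ⊤ ∧ ∀ (f : ℂ → ℝ) (G : ℂ → ℂ), MemHomSobolev p Ω f G →
    ∃ H : ℂ → ℂ, MemHomSobolev q Ω' (f ∘ ψ) H ∧ gradNorm q Ω' H ≤ K * gradNorm p Ω G}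

/-- The open unit disc. -/
def unitDisc : Set ℂ := Metric.ball 0 1

/-- `φ` is a conformal homeomorphism of `Ω` onto `Ω'`: a holomorphic bijection. -/
def IsConformalHomeo (Ω Ω' : Set ℂ) (φ : ℂ → ℂ) : Prop :=
  DifferentiableOn ℂ φ Ω ∧ BijOn φ Ω Ω'

/-- The conformal weight `J(z, φ) = |φ'(z)|²`. -/
noncomputable def conformalWeight (φ : ℂ → ℂ) (z : ℂ) : ℝ := ‖deriv φ z‖ ^ 2

/-- (Inverse) Brennan's conjecture holds for the interval `[α₀, 2/3)`: the derivative of any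
conformal mapping of the unit disc onto a planar domain belongs to `L^α` of the disc for every
`α ∈ [α₀, 2/3)`. -/
def BrennanConjectureOn (α₀ : ℝ) : Prop :=
  ∀ (ψ : ℂ → ℂ) (Ω : Set ℂ), IsConformalHomeo unitDisc Ω ψ → ∀ α ∈ Ico α₀ (2 / 3),
    ∫⁻ w in unitDisc, ‖deriv ψ w‖ₑ ^ α < ⊤

/-! The inequality on Ω is transported to the disc by ψ = φ⁻¹, written `Function.invFunOn φ Ω`. The
weight |φ'|² is the Jacobian of φ, so ∫_Ω |f - c|^r h equals ∫_𝔻 |f∘ψ - c|^r for every c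
(`infDistConst_comp_invFunOn`). The weak gradient of f∘ψ is conj(ψ')·(G∘ψ), and Hölder's inequality
with exponents p/(p-q) and p/q bounds its L^q norm by the stated power of ∫|ψ'|^((p-2)q/(p-q)) times
‖G‖_p (`gradNorm_comp_invFunOn_le`). Composing with the (r,q)-inequality on 𝔻 gives B_{r,p}(Ω,h) ≤
K_{p,q}·B_{r,q}(𝔻) (`poincareConst_conformalWeight_le`). Since 0·∞ = 0 in `ℝ≥0∞`, this also needs
both factors to be nonzero.

For finiteness put a = |α₀| and q = ap/(2-p+a). Then (p-2)q/(p-q) = α₀, so Brennan's hypothesis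
makes K_{p,q} finite, while 2q/(2-q) is exactly the largest admissible r. Hence the Sobolev–Poincaré
inequality on 𝔻 is needed up to its critical exponent (`poincareConst_unitDisc_lt_top`).

That inequality is proved for smooth functions on discs of radius ρ < 1. Gagliardo's argument on a
square and on a polar rectangle bounds the L² norm by the W^{1,1} norm; applied to |u|^(s/2) it
gives the critical Sobolev inequality. Integration along segments gives Poincaré's inequality.
Mollification, Fatou's lemma and exhaustion by discs pass to weakly differentiable functions on 𝔻.
-/

/-! ### Inverses of injective holomorphic maps -/

open Filter Topology in
theorem nhds_le_map_nhds_of_injOn {Ω : Set ℂ} (hΩ : IsOpen Ω) {φ : ℂ → ℂ}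
    (hd : DifferentiableOn ℂ φ Ω) (hi : InjOn φ Ω) {z : ℂ} (hz : z ∈ Ω) :
    𝓝 (φ z) ≤ map φ (𝓝 z) := by
  have han : AnalyticAt ℂ φ z := hd.analyticAt (hΩ.mem_nhds hz)
  refine han.eventually_constant_or_nhds_le_map_nhds.resolve_left fun h => ?_
  have h2 : ∀ᶠ w in 𝓝[≠] z, φ w = φ z ∧ w ∈ Ω :=
    (h.and (hΩ.mem_nhds hz)).filter_mono nhdsWithin_le_nhds
  obtain ⟨w, ⟨hw, hwΩ⟩, hne⟩ := (h2.and self_mem_nhdsWithin).exists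
  exact hne (hi hwΩ hz hw)

open Filter Topology in
theorem continuousAt_invFunOn_of_injOn {Ω : Set ℂ} (hΩ : IsOpen Ω) {φ : ℂ → ℂ}
    (hd : DifferentiableOn ℂ φ Ω) (hi : InjOn φ Ω) {z : ℂ} (hz : z ∈ Ω) :
    ContinuousAt (Function.invFunOn φ Ω) (φ z) := by
  intro U hU
  rw [hi.leftInvOn_invFunOn hz] at hU
  have h1 : φ '' (U ∩ Ω) ∈ 𝓝 (φ z) := nhds_le_map_nhds_of_injOn hΩ hd hi hz
    (image_mem_map (inter_mem hU (hΩ.mem_nhds hz)))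
  refine Filter.mem_map.2 (mem_of_superset h1 ?_)
  rintro _ ⟨w, ⟨hwU, hwΩ⟩, rfl⟩
  simpa [hi.leftInvOn_invFunOn hwΩ] using hwU

theorem isOpen_image_of_injOn {Ω : Set ℂ} (hΩ : IsOpen Ω) {φ : ℂ → ℂ}
    (hd : DifferentiableOn ℂ φ Ω) (hi : InjOn φ Ω) : IsOpen (φ '' Ω) := by
  rw [isOpen_iff_mem_nhds]
  rintro _ ⟨z, hz, rfl⟩
  exact nhds_le_map_nhds_of_injOn hΩ hd hi hz (Filter.image_mem_map (hΩ.mem_nhds hz))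

-- The zeros of φ' are isolated unless φ' vanishes near z; then φ would be constant on a ball,
-- against injectivity.
open Filter Topology in
theorem eventually_deriv_ne_zero_of_injOn {Ω : Set ℂ} (hΩ : IsOpen Ω) {φ : ℂ → ℂ}
    (hd : DifferentiableOn ℂ φ Ω) (hi : InjOn φ Ω) {z : ℂ} (hz : z ∈ Ω) :
    ∀ᶠ w in 𝓝[≠] z, deriv φ w ≠ 0 := by
  have han : AnalyticAt ℂ φ z := hd.analyticAt (hΩ.mem_nhds hz)
  refine han.deriv.eventually_eq_zero_or_eventually_ne_zero.resolve_left fun h => ?_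
  obtain ⟨ε, hε, hball⟩ := Metric.mem_nhds_iff.1 (h.and (hΩ.mem_nhds hz))
  have hconst : ∀ w ∈ Metric.ball z ε, φ w = φ z := by
    intro w hw
    refine (convex_ball z ε).is_const_of_fderivWithin_eq_zero (𝕜 := ℂ)
      (hd.mono fun x hx => (hball hx).2) ?_ hw (Metric.mem_ball_self hε)
    intro x hx
    rw [fderivWithin_of_isOpen Metric.isOpen_ball hx]
    ext
    simpa using (hball hx).1
  have h2 : ∀ᶠ w in 𝓝[≠] z, w ∈ Metric.ball z ε := nhdsWithin_le_nhds (Metric.ball_mem_nhds z hε)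
  obtain ⟨w, hw, hne⟩ := (h2.and self_mem_nhdsWithin).exists
  exact hne (hi (hball hw).2 hz (hconst w hw))

-- Off the critical points of φ the inverse is differentiable by the inverse function rule. Critical
-- points are isolated and the inverse is continuous, so the remaining singularities are removable.
-- That φ' has no zeros is then a consequence of the chain rule.
open Filter Topology in
theorem differentiableAt_invFunOn_of_injOn {Ω : Set ℂ} (hΩ : IsOpen Ω) {φ : ℂ → ℂ}
    (hd : DifferentiableOn ℂ φ Ω) (hi : InjOn φ Ω) {z : ℂ} (hz : z ∈ Ω) :
    DifferentiableAt ℂ (Function.invFunOn φ Ω) (φ z) := by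
  have hreg : ∀ w ∈ Ω, deriv φ w ≠ 0 → DifferentiableAt ℂ (Function.invFunOn φ Ω) (φ w) := by
    intro w hw hne
    have hc := continuousAt_invFunOn_of_injOn hΩ hd hi hw
    have hdw : HasDerivAt φ (deriv φ w) (Function.invFunOn φ Ω (φ w)) := by
      rw [hi.leftInvOn_invFunOn hw]
      exact (hd.differentiableAt (hΩ.mem_nhds hw)).hasDerivAt
    refine (hdw.of_local_left_inverse hc hne ?_).differentiableAt
    filter_upwards [(isOpen_image_of_injOn hΩ hd hi).mem_nhds (mem_image_of_mem φ hw)] with y hy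
    exact Function.invFunOn_eq hy
  obtain ⟨ε, hε, hball⟩ := Metric.mem_nhdsWithin_iff.1 (eventually_deriv_ne_zero_of_injOn hΩ hd hi hz)
  have hU : IsOpen (Metric.ball z ε ∩ Ω) := Metric.isOpen_ball.inter hΩ
  have hV : IsOpen (φ '' (Metric.ball z ε ∩ Ω)) :=
    isOpen_image_of_injOn hU (hd.mono inter_subset_right) (hi.mono inter_subset_right)
  have hmem : φ '' (Metric.ball z ε ∩ Ω) ∈ 𝓝 (φ z) :=
    hV.mem_nhds (mem_image_of_mem φ ⟨Metric.mem_ball_self hε, hz⟩)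
  refine ((Complex.differentiableOn_compl_singleton_and_continuousAt_iff hmem).1
    ⟨?_, continuousAt_invFunOn_of_injOn hΩ hd hi hz⟩).differentiableAt hmem
  rintro _ ⟨⟨w, ⟨hwb, hw⟩, rfl⟩, hne⟩
  exact (hreg w hw (hball ⟨hwb, fun h => hne (by rw [mem_singleton_iff.1 h]; rfl)⟩)).differentiableWithinAt

theorem deriv_invFunOn_mul_deriv {Ω : Set ℂ} (hΩ : IsOpen Ω) {φ : ℂ → ℂ}
    (hd : DifferentiableOn ℂ φ Ω) (hi : InjOn φ Ω) {z : ℂ} (hz : z ∈ Ω) :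
    deriv (Function.invFunOn φ Ω) (φ z) * deriv φ z = 1 := by
  have h1 := (differentiableAt_invFunOn_of_injOn hΩ hd hi hz).hasDerivAt.comp z
    (hd.differentiableAt (hΩ.mem_nhds hz)).hasDerivAt
  have h2 : HasDerivAt (Function.invFunOn φ Ω ∘ φ) 1 z := by
    refine (hasDerivAt_id z).congr_of_eventuallyEq ?_
    filter_upwards [hΩ.mem_nhds hz] with w hw
    exact hi.leftInvOn_invFunOn hw
  exact h1.unique h2

/-- The inverse of a conformal homeomorphism of an open set is a conformal homeomorphism. -/
theorem IsConformalHomeo.invFunOn {Ω Ω' : Set ℂ} (hΩ : IsOpen Ω) {φ : ℂ → ℂ}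
    (h : IsConformalHomeo Ω Ω' φ) : IsConformalHomeo Ω' Ω (Function.invFunOn φ Ω) := by
  obtain ⟨hd, hb⟩ := h
  refine ⟨?_, ?_⟩
  · intro w hw
    obtain ⟨z, hz, rfl⟩ := hb.surjOn hw
    exact (differentiableAt_invFunOn_of_injOn hΩ hd hb.injOn hz).differentiableWithinAt
  · exact hb.invOn_invFunOn.symm.bijOn (hb.surjOn.mapsTo_invFunOn) hb.mapsTo

/-! ### Holomorphic change of variables -/

theorem Complex.det_restrictScalars_mul (a : ℂ) :
    ((ContinuousLinearMap.toSpanSingleton ℂ a).restrictScalars ℝ : ℂ →L[ℝ] ℂ).det = ‖a‖ ^ 2 := by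
  rw [ContinuousLinearMap.det, ContinuousLinearMap.coe_restrictScalars, LinearMap.det_restrictScalars]
  simp [Algebra.norm_complex_apply, Complex.normSq_eq_norm_sq]

section ChangeOfVariables

variable {A : Set ℂ} {F : ℂ → ℂ}

theorem hasFDerivWithinAt_restrictScalars_of_isOpen (hA : IsOpen A) (hF : DifferentiableOn ℂ F A)
    {s : Set ℂ} (hs : s ⊆ A) :
    ∀ z ∈ s, HasFDerivWithinAt F
      ((ContinuousLinearMap.toSpanSingleton ℂ (deriv F z)).restrictScalars ℝ) s z := fun _ hz =>
  ((hF.differentiableAt (hA.mem_nhds (hs hz))).hasDerivAt.hasFDerivAt.restrictScalars ℝ).hasFDerivWithinAt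

theorem lintegral_image_eq_of_holomorphic (hA : IsOpen A) (hF : DifferentiableOn ℂ F A)
    {s : Set ℂ} (hs : s ⊆ A) (hsm : MeasurableSet s) (hi : InjOn F s) (g : ℂ → ℝ≥0∞) :
    ∫⁻ w in F '' s, g w = ∫⁻ z in s, ‖deriv F z‖ₑ ^ (2 : ℝ) * g (F z) := by
  rw [lintegral_image_eq_lintegral_abs_det_fderiv_mul volume hsm
    (hasFDerivWithinAt_restrictScalars_of_isOpen hA hF hs) hi]
  refine lintegral_congr fun z => ?_
  rw [Complex.det_restrictScalars_mul, abs_of_nonneg (by positivity), ENNReal.ofReal_pow (norm_nonneg _),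
    ofReal_norm]
  norm_num

theorem integral_image_eq_of_holomorphic (hA : IsOpen A) (hF : DifferentiableOn ℂ F A)
    {s : Set ℂ} (hs : s ⊆ A) (hsm : MeasurableSet s) (hi : InjOn F s) (g : ℂ → ℝ) :
    ∫ w in F '' s, g w = ∫ z in s, ‖deriv F z‖ ^ 2 * g (F z) := by
  rw [integral_image_eq_integral_abs_det_fderiv_smul volume hsm
    (hasFDerivWithinAt_restrictScalars_of_isOpen hA hF hs) hi]
  simp_rw [Complex.det_restrictScalars_mul, smul_eq_mul, abs_pow, abs_norm]

theorem integrableOn_image_iff_of_holomorphic {E : Type*} [NormedAddCommGroup E] [NormedSpace ℝ E]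
    (hA : IsOpen A) (hF : DifferentiableOn ℂ F A)
    {s : Set ℂ} (hs : s ⊆ A) (hsm : MeasurableSet s) (hi : InjOn F s) (g : ℂ → E) :
    IntegrableOn g (F '' s) ↔ IntegrableOn (fun z => ‖deriv F z‖ ^ 2 • g (F z)) s := by
  rw [integrableOn_image_iff_integrableOn_abs_det_fderiv_smul volume hsm
    (hasFDerivWithinAt_restrictScalars_of_isOpen hA hF hs) hi]
  simp_rw [Complex.det_restrictScalars_mul, abs_pow, abs_norm]

end ChangeOfVariables

/-- The change of variables yields integrability on compact sets with the extra factor |F'|², whose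
reciprocal is continuous because F' has no zeros. -/
theorem LocallyIntegrableOn.comp_of_holomorphic {E : Type*} [NormedAddCommGroup E] [NormedSpace ℝ E]
    {A B : Set ℂ} {F : ℂ → ℂ} (hA : IsOpen A) (hB : IsOpen B)
    (hF : DifferentiableOn ℂ F A) (hi : InjOn F A) (hm : MapsTo F A B)
    (hne : ∀ z ∈ A, deriv F z ≠ 0) {g : ℂ → E} (hg : LocallyIntegrableOn g B) :
    LocallyIntegrableOn (g ∘ F) A := by
  rw [locallyIntegrableOn_iff hA.isLocallyClosed]
  intro K hKA hK
  have h1 : IntegrableOn g (F '' K) :=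
    (locallyIntegrableOn_iff hB.isLocallyClosed).1 hg _ (hm.mono_left hKA).image_subset
      (hK.image_of_continuousOn (hF.continuousOn.mono hKA))
  rw [integrableOn_image_iff_of_holomorphic hA hF hKA hK.measurableSet (hi.mono hKA)] at h1
  have hc : ContinuousOn (fun z => (‖deriv F z‖ ^ 2)⁻¹) K := by
    refine ContinuousOn.inv₀ ((((hF.deriv hA).continuousOn.mono hKA).norm).pow 2) fun z hz => ?_
    exact pow_ne_zero _ (norm_ne_zero_iff.2 (hne z (hKA hz)))
  refine (h1.continuousOn_smul hc hK).congr_fun (fun z hz => ?_) hK.measurableSet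
  have : ‖deriv F z‖ ^ 2 ≠ 0 := pow_ne_zero _ (norm_ne_zero_iff.2 (hne z (hKA hz)))
  simp [smul_smul, inv_mul_cancel₀ this]

theorem MeasureTheory.LocallyIntegrableOn.integrableOn_mul_of_tsupport_subset {Ω : Set ℂ} (hΩ : IsOpen Ω)
    {f g : ℂ → ℝ} (hf : LocallyIntegrableOn f Ω) (hg : Continuous g) (hc : HasCompactSupport g)
    (hs : tsupport g ⊆ Ω) : IntegrableOn (fun z => f z * g z) Ω := by
  have h1 : IntegrableOn f (tsupport g) :=
    (locallyIntegrableOn_iff hΩ.isLocallyClosed).1 hf _ hs hc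
  have h2 := h1.mul_continuousOn hg.continuousOn hc
  have h3 : Integrable (fun z => f z * g z) := by
    refine (integrableOn_iff_integrable_of_support_subset ?_).1 h2
    exact (Function.support_mul_subset_right _ _).trans (subset_tsupport g)
  exact h3.integrableOn

theorem eLpNorm_eq_gradNorm {p : ℝ} (hp : 0 < p) (Ω : Set ℂ) (G : ℂ → ℂ) :
    eLpNorm G (ENNReal.ofReal p) (volume.restrict Ω) = gradNorm p Ω G := by
  rw [eLpNorm_eq_lintegral_rpow_enorm_toReal (by simpa using hp) ENNReal.ofReal_ne_top,
    ENNReal.toReal_ofReal hp.le, gradNorm]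

/-! ### Composition with the inverse conformal map -/

section Composition

variable {Ω Ω' : Set ℂ} {φ : ℂ → ℂ} {f : ℂ → ℝ} {G : ℂ → ℂ}

/-- Supplies test functions on Ω from those on Ω': the support lies in the compact set φ⁻¹(supp η) ⊆
Ω, so extension by zero stays smooth. -/
theorem contDiff_indicator_comp_mul (hΩ : IsOpen Ω) (h : IsConformalHomeo Ω Ω' φ)
    {η g : ℂ → ℝ} (hη : ContDiff ℝ ∞ η) (hηc : HasCompactSupport η) (hηs : tsupport η ⊆ Ω')
    (hg : ContDiffOn ℝ ∞ g Ω) :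
    let ζ := Ω.indicator fun z => η (φ z) * g z
    ContDiff ℝ ∞ ζ ∧ HasCompactSupport ζ ∧ tsupport ζ ⊆ Ω := by
  intro ζ
  have hinv := h.invFunOn hΩ
  set K := Function.invFunOn φ Ω '' tsupport η with hK
  have hKc : IsCompact K := hηc.isCompact.image_of_continuousOn (hinv.1.continuousOn.mono hηs)
  have hKΩ : K ⊆ Ω := (hinv.2.mapsTo.mono_left hηs).image_subset
  have hsupp : Function.support ζ ⊆ K := by
    intro z hz
    have hzΩ : z ∈ Ω := by
      by_contra hn
      exact hz (indicator_of_notMem hn _)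
    refine ⟨φ z, subset_tsupport _ fun h0 => hz ?_, h.2.injOn.leftInvOn_invFunOn hzΩ⟩
    simp [ζ, h0]
  have hts : tsupport ζ ⊆ K := closure_minimal hsupp hKc.isClosed
  refine ⟨?_, hKc.of_isClosed_subset (isClosed_tsupport _) hts, hts.trans hKΩ⟩
  rw [contDiff_iff_contDiffAt]
  intro x
  by_cases hx : x ∈ Ω
  · have hφ : ContDiffOn ℝ ∞ φ Ω := (h.1.contDiffOn hΩ).restrict_scalars ℝ
    have h1 : ContDiffOn ℝ ∞ (fun z => η (φ z) * g z) Ω := (hη.comp_contDiffOn hφ).mul hg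
    refine (h1.contDiffAt (hΩ.mem_nhds hx)).congr_of_eventuallyEq ?_
    filter_upwards [hΩ.mem_nhds hx] with z hz
    exact indicator_of_mem hz _
  · refine (contDiffAt_const (c := (0 : ℝ))).congr_of_eventuallyEq ?_
    filter_upwards [hKc.isClosed.isOpen_compl.mem_nhds fun hn => hx (hKΩ hn)] with z hz
    by_contra hne
    exact hz (hsupp hne)

open ComplexConjugate in
/-- The chain rule for weak gradients under conformal homeomorphisms. -/
theorem HasWeakGradientOn.comp_invFunOn (hΩ : IsOpen Ω) (hΩ' : IsOpen Ω')
    (h : IsConformalHomeo Ω Ω' φ) (hf : HasWeakGradientOn Ω f G) :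
    HasWeakGradientOn Ω' (f ∘ Function.invFunOn φ Ω) fun w =>
      conj (deriv (Function.invFunOn φ Ω) w) * G (Function.invFunOn φ Ω w) := by
  have hinv := h.invFunOn hΩ
  set ψ := Function.invFunOn φ Ω with hψ
  have hder : ∀ z ∈ Ω, deriv ψ (φ z) * deriv φ z = 1 := fun z hz =>
    deriv_invFunOn_mul_deriv hΩ h.1 h.2.injOn hz
  have hne : ∀ w ∈ Ω', deriv ψ w ≠ 0 := by
    intro w hw
    obtain ⟨z, hz, rfl⟩ := h.2.surjOn hw
    exact left_ne_zero_of_mul_eq_one (hder z hz)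
  obtain ⟨hfl, hGl, hw⟩ := hf
  refine ⟨LocallyIntegrableOn.comp_of_holomorphic hΩ' hΩ hinv.1 hinv.2.injOn hinv.2.mapsTo hne hfl,
    ?_, ?_⟩
  · have hc : ContinuousOn (fun w => conj (deriv ψ w)) Ω' :=
      Complex.continuous_conj.comp_continuousOn (hinv.1.deriv hΩ').continuousOn
    exact (LocallyIntegrableOn.comp_of_holomorphic hΩ' hΩ hinv.1 hinv.2.injOn hinv.2.mapsTo hne
      hGl).continuousOn_mul hc hΩ'.isLocallyClosed
  · intro η hη hηc hηs v
    have hφ' : DifferentiableOn ℂ (deriv φ) Ω := h.1.deriv hΩ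
    -- The weak formulation on Ω is tested with the two components of the field η(φ)·conj(φ')·v,
    -- which is the Piola pullback |φ'|²(dφ)⁻¹(ηv) of ηv.
    have hX : ContDiffOn ℝ ∞ (fun z => conj (deriv φ z) * v) Ω :=
      (Complex.conjCLE.contDiff.comp_contDiffOn
        ((hφ'.contDiffOn hΩ).restrict_scalars ℝ)).mul contDiffOn_const
    obtain ⟨s1, c1, t1⟩ := contDiff_indicator_comp_mul hΩ h hη hηc hηs
      (g := fun z => (conj (deriv φ z) * v).re) (Complex.reCLM.contDiff.comp_contDiffOn hX)
    obtain ⟨s2, c2, t2⟩ := contDiff_indicator_comp_mul hΩ h hη hηc hηs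
      (g := fun z => (conj (deriv φ z) * v).im) (Complex.imCLM.contDiff.comp_contDiffOn hX)
    set ζ1 := Ω.indicator fun z => η (φ z) * (conj (deriv φ z) * v).re
    set ζ2 := Ω.indicator fun z => η (φ z) * (conj (deriv φ z) * v).im
    have e1 := hw ζ1 s1 c1 t1 1
    have e2 := hw ζ2 s2 c2 t2 Complex.I
    -- The divergence of the pulled-back field: conj(φ')·v is antiholomorphic in z, hence
    -- divergence-free by Cauchy–Riemann, and only the derivative of η∘φ contributes.
    have key : ∀ z ∈ Ω, fderiv ℝ ζ1 z 1 + fderiv ℝ ζ2 z Complex.I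
        = ‖deriv φ z‖ ^ 2 * fderiv ℝ η (φ z) v := by
      intro z hz
      have hφz := (h.1.differentiableAt (hΩ.mem_nhds hz)).hasDerivAt.hasFDerivAt.restrictScalars ℝ
      have hφ'z := (hφ'.differentiableAt (hΩ.mem_nhds hz)).hasDerivAt.hasFDerivAt.restrictScalars ℝ
      have hηz := ((hη.differentiable (by simp)) (φ z)).hasFDerivAt.comp z hφz
      have hXz := (Complex.conjCLE.toContinuousLinearMap.hasFDerivAt.comp z hφ'z).mul_const' v
      have d1 := hηz.mul (Complex.reCLM.hasFDerivAt.comp z hXz)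
      have d2 := hηz.mul (Complex.imCLM.hasFDerivAt.comp z hXz)
      have ev1 : ζ1 =ᶠ[nhds z] _ := Filter.eventuallyEq_of_mem (hΩ.mem_nhds hz)
        fun y hy => indicator_of_mem hy _
      have ev2 : ζ2 =ᶠ[nhds z] _ := Filter.eventuallyEq_of_mem (hΩ.mem_nhds hz)
        fun y hy => indicator_of_mem hy _
      have E1 := (d1.congr_of_eventuallyEq ev1).fderiv
      have E2 := (d2.congr_of_eventuallyEq ev2).fderiv
      rw [E1, E2]
      have hX : (‖deriv φ z‖ ^ 2 : ℝ) * fderiv ℝ η (φ z) v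
          = (conj (deriv φ z) * v).re * fderiv ℝ η (φ z) (deriv φ z)
            + (conj (deriv φ z) * v).im * fderiv ℝ η (φ z) (Complex.I * deriv φ z) := by
        have hs (c : ℝ) (u : ℂ) : c * fderiv ℝ η (φ z) u = fderiv ℝ η (φ z) (c • u) := by
          rw [map_smul, smul_eq_mul]
        rw [hs, hs, hs, ← map_add]
        congr 1
        simp only [Complex.real_smul]
        have h1 : ((‖deriv φ z‖ ^ 2 : ℝ) : ℂ) = deriv φ z * conj (deriv φ z) := by
          rw [Complex.mul_conj, Complex.normSq_eq_norm_sq]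
        rw [h1]
        conv_lhs => rw [mul_assoc, ← Complex.re_add_im (conj (deriv φ z) * v)]
        ring
      rw [hX]
      simp
      ring
    have a1 := hfl.integrableOn_mul_of_tsupport_subset hΩ (g := fun z => fderiv ℝ ζ1 z 1)
      ((s1.continuous_fderiv (by simp)).clm_apply continuous_const) (c1.fderiv_apply ℝ 1)
      ((tsupport_fderiv_apply_subset ℝ 1).trans t1)
    have a2 := hfl.integrableOn_mul_of_tsupport_subset hΩ (g := fun z => fderiv ℝ ζ2 z Complex.I)
      ((s2.continuous_fderiv (by simp)).clm_apply continuous_const) (c2.fderiv_apply ℝ Complex.I)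
      ((tsupport_fderiv_apply_subset ℝ Complex.I).trans t2)
    have hGre : LocallyIntegrableOn (fun z => (inner ℝ (G z) 1 : ℝ)) Ω := fun x hx => by
      obtain ⟨s, hs, hi⟩ := hGl x hx
      exact ⟨s, hs, hi.inner_const 1⟩
    have hGim : LocallyIntegrableOn (fun z => (inner ℝ (G z) Complex.I : ℝ)) Ω := fun x hx => by
      obtain ⟨s, hs, hi⟩ := hGl x hx
      exact ⟨s, hs, hi.inner_const Complex.I⟩
    have b1 := hGre.integrableOn_mul_of_tsupport_subset hΩ s1.continuous c1 t1
    have b2 := hGim.integrableOn_mul_of_tsupport_subset hΩ s2.continuous c2 t2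
    have L : ∫ w in Ω', (f ∘ ψ) w * fderiv ℝ η w v
        = (∫ z in Ω, f z * fderiv ℝ ζ1 z 1) + ∫ z in Ω, f z * fderiv ℝ ζ2 z Complex.I := by
      rw [← integral_add a1 a2, ← h.2.image_eq, integral_image_eq_of_holomorphic hΩ h.1 subset_rfl
        hΩ.measurableSet h.2.injOn]
      refine setIntegral_congr_fun hΩ.measurableSet fun z hz => ?_
      have : f (ψ (φ z)) = f z := by rw [hψ, h.2.injOn.leftInvOn_invFunOn hz]
      simp only [Function.comp_apply, this]
      linear_combination (-f z) * key z hz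
    have R : ∫ w in Ω', inner ℝ (conj (deriv ψ w) * G (ψ w)) v * η w
        = (∫ z in Ω, inner ℝ (G z) 1 * ζ1 z) + ∫ z in Ω, inner ℝ (G z) Complex.I * ζ2 z := by
      rw [← integral_add b1 b2, ← h.2.image_eq, integral_image_eq_of_holomorphic hΩ h.1 subset_rfl
        hΩ.measurableSet h.2.injOn]
      refine setIntegral_congr_fun hΩ.measurableSet fun z hz => ?_
      have e3 : ψ (φ z) = z := by rw [hψ, h.2.injOn.leftInvOn_invFunOn hz]
      have e4 : ζ1 z = η (φ z) * (conj (deriv φ z) * v).re := indicator_of_mem hz _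
      have e5 : ζ2 z = η (φ z) * (conj (deriv φ z) * v).im := indicator_of_mem hz _
      have e6 : ((‖deriv φ z‖ ^ 2 : ℝ) : ℂ) * conj (conj (deriv ψ (φ z)) * G z) * v
          = conj (G z) * (conj (deriv φ z) * v) := by
        rw [← Complex.normSq_eq_norm_sq, ← Complex.mul_conj]
        simp only [map_mul, Complex.conj_conj]
        linear_combination (conj (G z) * conj (deriv φ z) * v) * hder z hz
      have e7 : ‖deriv φ z‖ ^ 2 * (conj (conj (deriv ψ (φ z)) * G z) * v).re
          = (conj (G z) * (conj (deriv φ z) * v)).re := by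
        rw [← e6, mul_assoc, Complex.re_ofReal_mul]
      simp only [e3, e4, e5, Complex.inner] at e7 ⊢
      rw [← mul_assoc, mul_comm v, e7, Complex.mul_re (conj (G z))]
      simp only [Complex.mul_re Complex.I, Complex.conj_re, Complex.conj_im, one_mul,
        Complex.I_re, Complex.I_im]
      ring
    rw [L, R, e1, e2]
    ring

-- Hölder's inequality after splitting |ψ'|^q as |ψ'|^(q(p-2)/p) · |ψ'|^(2q/p): raised to the power
-- p/q, the second factor becomes the Jacobian |ψ'|² and turns ∫|G∘ψ|^p into an integral over Ω.
open ComplexConjugate in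
theorem gradNorm_comp_invFunOn_le (hΩ : IsOpen Ω) (hΩ' : IsOpen Ω')
    (h : IsConformalHomeo Ω Ω' φ) {p q : ℝ} (hq : 0 < q) (hqp : q < p)
    (hG : LocallyIntegrableOn G Ω) :
    gradNorm q Ω' (fun w =>
      conj (deriv (Function.invFunOn φ Ω) w) * G (Function.invFunOn φ Ω w)) ≤
      (∫⁻ w in Ω', ‖deriv (Function.invFunOn φ Ω) w‖ₑ ^ ((p - 2) * q / (p - q))) ^
          ((p - q) / (p * q)) * gradNorm p Ω G := by
  have hinv := h.invFunOn hΩ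
  set ψ := Function.invFunOn φ Ω with hψ
  have hp : 0 < p := hq.trans hqp
  have hpq : 0 < p - q := sub_pos.2 hqp
  have hne : ∀ w ∈ Ω', deriv ψ w ≠ 0 := by
    intro w hw
    obtain ⟨z, hz, rfl⟩ := h.2.surjOn hw
    exact left_ne_zero_of_mul_eq_one (deriv_invFunOn_mul_deriv hΩ h.1 h.2.injOn hz)
  have mψ : AEMeasurable (fun w => ‖deriv ψ w‖ₑ) (volume.restrict Ω') :=
    ((hinv.1.deriv hΩ').continuousOn.aestronglyMeasurable hΩ'.measurableSet).enorm
  have mG : AEMeasurable (fun w => ‖G (ψ w)‖ₑ) (volume.restrict Ω') :=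
    (LocallyIntegrableOn.comp_of_holomorphic hΩ' hΩ hinv.1 hinv.2.injOn hinv.2.mapsTo hne
      hG).aestronglyMeasurable.enorm
  have hHol : (p / (p - q)).HolderConjugate (p / q) := by
    rw [Real.holderConjugate_iff]
    refine ⟨by rw [lt_div_iff₀ hpq]; linarith, ?_⟩
    field_simp
    ring
  have I1 : ∫⁻ w in Ω', ‖conj (deriv ψ w) * G (ψ w)‖ₑ ^ q
      = ∫⁻ w in Ω', ‖deriv ψ w‖ₑ ^ (q * (p - 2) / p) * (‖deriv ψ w‖ₑ ^ (2 * q / p) * ‖G (ψ w)‖ₑ ^ q) := by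
    refine setLIntegral_congr_fun hΩ'.measurableSet fun w hw => ?_
    have h0 : ‖deriv ψ w‖ₑ ≠ 0 := by simpa using hne w hw
    simp only [enorm_mul, RCLike.enorm_conj]
    rw [ENNReal.mul_rpow_of_nonneg _ _ hq.le, ← mul_assoc, ← ENNReal.rpow_add _ _ h0 enorm_ne_top]
    congr 2
    field_simp
    ring
  have I2 : ∫⁻ w in Ω', (‖deriv ψ w‖ₑ ^ (2 * q / p) * ‖G (ψ w)‖ₑ ^ q) ^ (p / q)
      = ∫⁻ z in Ω, ‖G z‖ₑ ^ p := by
    rw [← hinv.2.image_eq, lintegral_image_eq_of_holomorphic hΩ' hinv.1 subset_rfl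
      hΩ'.measurableSet hinv.2.injOn]
    refine lintegral_congr fun w => ?_
    rw [ENNReal.mul_rpow_of_nonneg _ _ (by positivity), ← ENNReal.rpow_mul, ← ENNReal.rpow_mul]
    congr 2 <;> field_simp
  have I3 : ∫⁻ w in Ω', (‖deriv ψ w‖ₑ ^ (q * (p - 2) / p)) ^ (p / (p - q))
      = ∫⁻ w in Ω', ‖deriv ψ w‖ₑ ^ ((p - 2) * q / (p - q)) := by
    refine lintegral_congr fun w => ?_
    rw [← ENNReal.rpow_mul]
    congr 1
    field_simp
  have := ENNReal.lintegral_mul_le_Lp_mul_Lq (volume.restrict Ω') hHol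
    (f := fun w => ‖deriv ψ w‖ₑ ^ (q * (p - 2) / p))
    (g := fun w => ‖deriv ψ w‖ₑ ^ (2 * q / p) * ‖G (ψ w)‖ₑ ^ q) (mψ.pow_const _)
    ((mψ.pow_const _).mul (mG.pow_const _))
  simp only [Pi.mul_apply] at this
  rw [I2, I3, ← I1] at this
  have h4 := ENNReal.rpow_le_rpow this (z := 1 / q) (by positivity)
  rw [ENNReal.mul_rpow_of_nonneg _ _ (by positivity), ← ENNReal.rpow_mul, ← ENNReal.rpow_mul] at h4
  unfold gradNorm
  convert h4 using 3 <;> field_simp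

theorem compositionNorm_invFunOn_le (hΩ : IsOpen Ω) (hΩ' : IsOpen Ω')
    (h : IsConformalHomeo Ω Ω' φ) {p q : ℝ} (hq : 0 < q) (hqp : q < p) :
    compositionNorm p q Ω Ω' (Function.invFunOn φ Ω) ≤
      (∫⁻ w in Ω', ‖deriv (Function.invFunOn φ Ω) w‖ₑ ^ ((p - 2) * q / (p - q))) ^
          ((p - q) / (p * q)) := by
  have hp : 0 < p := hq.trans hqp
  -- Only finite constants compete in `compositionNorm`, so an infinite bound is treated apart.
  rcases eq_top_or_lt_top ((∫⁻ w in Ω', ‖deriv (Function.invFunOn φ Ω) w‖ₑ ^ ((p - 2) * q / (p - q))) ^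
          ((p - q) / (p * q))) with ht | ht
  · rw [ht]; exact le_top
  refine sInf_le ⟨ht, fun f G hf => ?_⟩
  have hw := hf.1.comp_invFunOn hΩ hΩ' h
  have hle := gradNorm_comp_invFunOn_le hΩ hΩ' h hq hqp hf.1.2.1
  refine ⟨_, ⟨hw, hw.2.1.aestronglyMeasurable, ?_⟩, hle⟩
  rw [eLpNorm_eq_gradNorm hq]
  refine hle.trans_lt (ENNReal.mul_lt_top ht ?_)
  rw [← eLpNorm_eq_gradNorm hp]
  exact hf.2.2

theorem infDistConst_comp_invFunOn (hΩ : IsOpen Ω) (h : IsConformalHomeo Ω Ω' φ) (r : ℝ) (f : ℂ → ℝ) :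
    infDistConst r Ω' (fun _ => 1) (f ∘ Function.invFunOn φ Ω)
      = infDistConst r Ω (conformalWeight φ) f := by
  unfold infDistConst
  congr! 3 with c
  rw [← h.2.image_eq, lintegral_image_eq_of_holomorphic hΩ h.1 subset_rfl
      hΩ.measurableSet h.2.injOn]
  refine setLIntegral_congr_fun hΩ.measurableSet fun z hz => ?_
  have e3 : Function.invFunOn φ Ω (φ z) = z := by rw [h.2.injOn.leftInvOn_invFunOn hz]
  simp only [Function.comp_apply, e3, ENNReal.ofReal_one, mul_one, conformalWeight]
  rw [mul_comm, ENNReal.ofReal_pow (norm_nonneg _), ofReal_norm]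
  norm_num

end Composition

/-! ### Gagliardo and Sobolev inequalities for smooth functions on discs -/

theorem enorm_sub_le_lintegral_enorm_deriv {w w' : ℝ → ℝ} (hw : ∀ t, HasDerivAt w (w' t) t)
    (hc : Continuous w') {a b x t : ℝ} (hx : x ∈ Icc a b) (ht : t ∈ Icc a b) :
    ‖w x - w t‖ₑ ≤ ∫⁻ s in Ioo a b, ‖w' s‖ₑ := by
  rw [← intervalIntegral.integral_eq_sub_of_hasDerivAt (fun s _ => hw s)
    (hc.intervalIntegrable t x), intervalIntegral.intervalIntegral_eq_integral_uIoc, enorm_smul]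
  have h1 : ‖(if t ≤ x then 1 else -1 : ℝ)‖ₑ = 1 := by split_ifs <;> simp
  rw [h1, one_mul, setLIntegral_congr Ioo_ae_eq_Ioc]
  refine (enorm_integral_le_lintegral_enorm _).trans (lintegral_mono_set ?_)
  intro s hs
  rw [mem_uIoc] at hs
  rcases hs with hs | hs
  · exact ⟨ht.1.trans_lt hs.1, hs.2.trans hx.2⟩
  · exact ⟨hx.1.trans_lt hs.1, hs.2.trans ht.2⟩

/-- Average |w(x)| ≤ |w(t)| + ∫|w'| over t in the interval; L stands for any upper bound of 1/(b -
a). No boundary condition is needed. -/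
theorem enorm_le_lintegral_enorm_add_deriv {w w' : ℝ → ℝ} (hw : ∀ t, HasDerivAt w (w' t) t)
    (hc : Continuous w') {a b x : ℝ} (hx : x ∈ Ioo a b) {L : ℝ≥0∞}
    (hL : 1 ≤ ENNReal.ofReal (b - a) * L) :
    ‖w x‖ₑ ≤ ∫⁻ s in Ioo a b, (L * ‖w s‖ₑ + ‖w' s‖ₑ) := by
  have hwc : Continuous w := continuous_iff_continuousAt.2 fun t => (hw t).continuousAt
  rw [lintegral_add_right _ (by fun_prop), lintegral_const_mul _ (by fun_prop)]
  set J := ∫⁻ s in Ioo a b, ‖w' s‖ₑ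
  rw [← tsub_le_iff_right]
  have h1 : ∀ t ∈ Ioo a b, ‖w x‖ₑ - J ≤ ‖w t‖ₑ := by
    intro t ht
    rw [tsub_le_iff_right]
    have h := enorm_add_le (w t) (w x - w t)
    rw [add_sub_cancel] at h
    refine h.trans ?_
    gcongr
    exact enorm_sub_le_lintegral_enorm_deriv hw hc (Ioo_subset_Icc_self hx) (Ioo_subset_Icc_self ht)
  have h2 := setLIntegral_mono' (μ := volume) measurableSet_Ioo h1
  rw [setLIntegral_const, Real.volume_Ioo] at h2
  calc ‖w x‖ₑ - J ≤ (‖w x‖ₑ - J) * (ENNReal.ofReal (b - a) * L) := le_mul_of_one_le_right' hL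
    _ = L * ((‖w x‖ₑ - J) * ENNReal.ofReal (b - a)) := by ring
    _ ≤ _ := by gcongr

/-- The Gagliardo inequality on a rectangle. -/
theorem lintegral_lintegral_sq_le_of_rectangle {v vx vy : ℝ → ℝ → ℝ}
    (hx : ∀ x y, HasDerivAt (fun s => v s y) (vx x y) x)
    (hy : ∀ x y, HasDerivAt (fun t => v x t) (vy x y) y)
    (hxc : ∀ y, Continuous fun x => vx x y) (hyc : ∀ x, Continuous fun y => vy x y)
    {a b c d : ℝ} {L : ℝ≥0∞} (h1 : 1 ≤ ENNReal.ofReal (b - a) * L)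
    (h2 : 1 ≤ ENNReal.ofReal (d - c) * L) {F : ℝ → ℝ → ℝ≥0∞}
    (hF : Measurable (Function.uncurry F))
    (hFx : ∀ x ∈ Ioo a b, ∀ y ∈ Ioo c d, L * ‖v x y‖ₑ + ‖vx x y‖ₑ ≤ F x y)
    (hFy : ∀ x ∈ Ioo a b, ∀ y ∈ Ioo c d, L * ‖v x y‖ₑ + ‖vy x y‖ₑ ≤ F x y) :
    ∫⁻ x in Ioo a b, ∫⁻ y in Ioo c d, ‖v x y‖ₑ ^ (2 : ℝ) ≤
      (∫⁻ x in Ioo a b, ∫⁻ y in Ioo c d, F x y) ^ 2 := by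
  have mB : Measurable fun x => ∫⁻ t in Ioo c d, F x t := hF.lintegral_prod_right'
  have mA : Measurable fun y => ∫⁻ s in Ioo a b, F s y := hF.lintegral_prod_left'
  calc ∫⁻ x in Ioo a b, ∫⁻ y in Ioo c d, ‖v x y‖ₑ ^ (2 : ℝ)
      ≤ ∫⁻ x in Ioo a b, ∫⁻ y in Ioo c d, (∫⁻ t in Ioo c d, F x t) * ∫⁻ s in Ioo a b, F s y := by
        refine setLIntegral_mono' measurableSet_Ioo fun x hxm =>
          setLIntegral_mono' measurableSet_Ioo fun y hym => ?_
        -- One factor |v| is bounded along the vertical line through (x, y), a function of x alone,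
        -- the other along the horizontal line, a function of y alone; the double integral then
        -- factors.
        rw [ENNReal.rpow_two, sq]
        gcongr
        · exact (enorm_le_lintegral_enorm_add_deriv (hy x) (hyc x) hym h2).trans
            (setLIntegral_mono' measurableSet_Ioo fun t ht => hFy x hxm t ht)
        · exact (enorm_le_lintegral_enorm_add_deriv (fun s => hx s y) (hxc y) hxm h1).trans
            (setLIntegral_mono' measurableSet_Ioo fun s hs => hFx s hs y hym)
    _ = (∫⁻ x in Ioo a b, ∫⁻ t in Ioo c d, F x t) * ∫⁻ y in Ioo c d, ∫⁻ s in Ioo a b, F s y := by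
        rw [← lintegral_mul_const _ mB]
        exact lintegral_congr fun x => lintegral_const_mul _ mA
    _ = _ := by
        rw [sq, lintegral_lintegral_swap (f := fun y s => F s y) (hF.comp measurable_swap).aemeasurable]

theorem measurableSet_reProdIm {s t : Set ℝ} (hs : MeasurableSet s) (ht : MeasurableSet t) :
    MeasurableSet (s ×ℂ t) :=
  (Complex.measurable_re hs).inter (Complex.measurable_im ht)

theorem setLIntegral_reProdIm {g : ℂ → ℝ≥0∞} (hg : Measurable g) {s t : Set ℝ}
    (hs : MeasurableSet s) (ht : MeasurableSet t) :
    ∫⁻ z in s ×ℂ t, g z = ∫⁻ x in s, ∫⁻ y in t, g (x + y * Complex.I) := by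
  have h := Complex.volume_preserving_equiv_real_prod.symm.setLIntegral_comp_preimage
    (measurableSet_reProdIm hs ht) hg
  rw [← h, ← setLIntegral_prod (μ := volume) (ν := volume) (fun p : ℝ × ℝ => g (p.1 + p.2 * Complex.I))
    (by fun_prop)]
  refine lintegral_congr fun p => ?_
  congr 1
  exact Complex.mk_eq_add_mul_I _ _

open Real in
theorem setLIntegral_annulus {g : ℂ → ℝ≥0∞} (hg : Measurable g) {a b : ℝ} (ha : 0 ≤ a) :
    ∫⁻ z in {z : ℂ | ‖z‖ ∈ Ioo a b}, g z =
      ∫⁻ r in Ioo a b, ∫⁻ θ in Ioo (-π) π, ENNReal.ofReal r * g (r * Complex.exp (θ * Complex.I)) := by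
  have hS : MeasurableSet {z : ℂ | ‖z‖ ∈ Ioo a b} := measurable_norm measurableSet_Ioo
  rw [← lintegral_indicator hS, ← Complex.lintegral_comp_polarCoord_symm, polarCoord_target]
  rw [← setLIntegral_prod (μ := volume) (ν := volume)
    (fun p : ℝ × ℝ => ENNReal.ofReal p.1 * g (p.1 * Complex.exp (p.2 * Complex.I))) (by fun_prop)]
  have hsub : Ioo a b ×ˢ Ioo (-π) π ⊆ Ioi 0 ×ˢ Ioo (-π) π :=
    prod_mono (fun r hr => ha.trans_lt hr.1) subset_rfl
  have hm1 : MeasurableSet (Ioo a b ×ˢ Ioo (-π) π) := measurableSet_Ioo.prod measurableSet_Ioo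
  have hm2 : MeasurableSet (Ioi (0 : ℝ) ×ˢ Ioo (-π) π) := measurableSet_Ioi.prod measurableSet_Ioo
  rw [← lintegral_indicator hm1, ← lintegral_indicator hm2]
  refine lintegral_congr fun p => ?_
  by_cases hp : p ∈ Ioi (0 : ℝ) ×ˢ Ioo (-π) π
  · have hp1 : 0 < p.1 := hp.1
    have e : Complex.polarCoord.symm p = p.1 * Complex.exp (p.2 * Complex.I) := by
      rw [Complex.polarCoord_symm_apply, Complex.exp_mul_I, Complex.ofReal_cos, Complex.ofReal_sin]
    have en : ‖(p.1 * Complex.exp (p.2 * Complex.I) : ℂ)‖ = p.1 := by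
      rw [norm_mul, Complex.norm_exp_ofReal_mul_I, mul_one, Complex.norm_real, Real.norm_of_nonneg hp1.le]
    have hmem : (p.1 * Complex.exp (p.2 * Complex.I) : ℂ) ∈ {z : ℂ | ‖z‖ ∈ Ioo a b} ↔
        p.1 ∈ Ioo a b := by
      conv_rhs => rw [← en]
      rfl
    rw [indicator_of_mem hp, e]
    by_cases hq : p.1 ∈ Ioo a b
    · rw [indicator_of_mem (show p ∈ Ioo a b ×ˢ Ioo (-π) π from ⟨hq, hp.2⟩),
        indicator_of_mem (hmem.2 hq), smul_eq_mul]
    · rw [indicator_of_notMem (fun h => hq (hmem.1 h)),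
        indicator_of_notMem (fun h : p ∈ Ioo a b ×ˢ Ioo (-π) π => hq h.1), smul_zero]
  · rw [indicator_of_notMem hp, indicator_of_notMem (fun h => hp (hsub h))]

theorem enorm_fderiv_apply_le {u : ℂ → ℝ} (z v : ℂ) (hv : ‖v‖ ≤ 1) :
    ‖fderiv ℝ u z v‖ₑ ≤ ‖fderiv ℝ u z‖ₑ := by
  rw [← ofReal_norm, ← ofReal_norm]
  refine ENNReal.ofReal_le_ofReal (((fderiv ℝ u z).le_opNorm v).trans ?_)
  exact mul_le_of_le_one_right (norm_nonneg _) hv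

theorem one_le_ofReal_mul_four {x : ℝ} (h : 1 / 4 ≤ x) : 1 ≤ ENNReal.ofReal x * 4 := by
  calc (1 : ℝ≥0∞) = ENNReal.ofReal (1 / 4 * 4) := by norm_num
    _ ≤ ENNReal.ofReal (x * 4) := ENNReal.ofReal_le_ofReal (by linarith)
    _ = _ := by rw [ENNReal.ofReal_mul (by linarith)]; norm_num

section Gagliardo

variable {u : ℂ → ℝ}

theorem measurable_four_mul_enorm_add_enorm_fderiv (hu : ContDiff ℝ 1 u) :
    Measurable fun z => 4 * ‖u z‖ₑ + ‖fderiv ℝ u z‖ₑ := by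
  have h1 := hu.continuous
  have h2 := hu.continuous_fderiv one_ne_zero
  fun_prop

theorem setLIntegral_sq_square_le (hu : ContDiff ℝ 1 u) {s : ℝ} (hs : 1 / 4 ≤ s) :
    ∫⁻ z in Ioo (-s) s ×ℂ Ioo (-s) s, ‖u z‖ₑ ^ (2 : ℝ) ≤
      (∫⁻ z in Ioo (-s) s ×ℂ Ioo (-s) s, (4 * ‖u z‖ₑ + ‖fderiv ℝ u z‖ₑ)) ^ 2 := by
  have hc := hu.continuous
  have hc' := hu.continuous_fderiv one_ne_zero
  have hm := measurable_four_mul_enorm_add_enorm_fderiv hu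
  have hd : ∀ z, HasFDerivAt u (fderiv ℝ u z) z := fun z =>
    (hu.differentiable one_ne_zero z).hasFDerivAt
  rw [setLIntegral_reProdIm (by fun_prop) measurableSet_Ioo measurableSet_Ioo,
    setLIntegral_reProdIm hm measurableSet_Ioo measurableSet_Ioo]
  refine lintegral_lintegral_sq_le_of_rectangle (v := fun x y => u (x + y * Complex.I))
    (vx := fun x y => fderiv ℝ u (x + y * Complex.I) 1)
    (vy := fun x y => fderiv ℝ u (x + y * Complex.I) Complex.I) ?_ ?_ ?_ ?_
    (one_le_ofReal_mul_four (by linarith)) (one_le_ofReal_mul_four (by linarith)) ?_ ?_ ?_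
  · intro x y
    refine (hd _).comp_hasDerivAt x ?_
    exact (Complex.ofRealCLM.hasDerivAt (x := x)).add_const _
  · intro x y
    refine (hd _).comp_hasDerivAt y ?_
    simpa using ((Complex.ofRealCLM.hasDerivAt (x := y)).mul_const Complex.I).const_add (x : ℂ)
  · intro y; fun_prop
  · intro x; fun_prop
  · exact hm.comp (by fun_prop)
  · intro x _ y _
    gcongr
    exact enorm_fderiv_apply_le _ _ (by simp)
  · intro x _ y _
    gcongr
    exact enorm_fderiv_apply_le _ _ (by simp)

-- In polar coordinates the annulus is a rectangle. The angular derivative carries a factor r ≤ 1,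
-- and the Jacobian r lies between 1/4 and 1, which accounts for the outer constant 4.
open Real in
theorem setLIntegral_sq_annulus_le (hu : ContDiff ℝ 1 u) {ρ : ℝ} (hρ : 1 / 2 ≤ ρ) (hρ1 : ρ ≤ 1) :
    ∫⁻ z in {z : ℂ | ‖z‖ ∈ Ioo (ρ / 2) ρ}, ‖u z‖ₑ ^ (2 : ℝ) ≤
      (4 * ∫⁻ z in {z : ℂ | ‖z‖ ∈ Ioo (ρ / 2) ρ}, (4 * ‖u z‖ₑ + ‖fderiv ℝ u z‖ₑ)) ^ 2 := by
  have hc := hu.continuous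
  have hc' := hu.continuous_fderiv one_ne_zero
  have hm := measurable_four_mul_enorm_add_enorm_fderiv hu
  have hd : ∀ z, HasFDerivAt u (fderiv ℝ u z) z := fun z =>
    (hu.differentiable one_ne_zero z).hasFDerivAt
  have hρ0 : 0 ≤ ρ / 2 := by linarith
  rw [setLIntegral_annulus (by fun_prop) hρ0, setLIntegral_annulus hm hρ0]
  have key : ∫⁻ r in Ioo (ρ / 2) ρ, ∫⁻ θ in Ioo (-π) π,
        ‖u (r * Complex.exp (θ * Complex.I))‖ₑ ^ (2 : ℝ) ≤
      (∫⁻ r in Ioo (ρ / 2) ρ, ∫⁻ θ in Ioo (-π) π, (4 * ‖u (r * Complex.exp (θ * Complex.I))‖ₑ +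
        ‖fderiv ℝ u (r * Complex.exp (θ * Complex.I))‖ₑ)) ^ 2 := by
    refine lintegral_lintegral_sq_le_of_rectangle (v := fun r θ => u (r * Complex.exp (θ * Complex.I)))
      (vx := fun r θ => fderiv ℝ u (r * Complex.exp (θ * Complex.I)) (Complex.exp (θ * Complex.I)))
      (vy := fun r θ => fderiv ℝ u (r * Complex.exp (θ * Complex.I))
        (r * (Complex.exp (θ * Complex.I) * Complex.I))) ?_ ?_ ?_ ?_
      (one_le_ofReal_mul_four (by linarith))
      (one_le_ofReal_mul_four (by linarith [Real.pi_gt_three])) ?_ ?_ ?_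
    · intro r θ
      refine (hd _).comp_hasDerivAt r ?_
      simpa using (Complex.ofRealCLM.hasDerivAt (x := r)).mul_const (Complex.exp (θ * Complex.I))
    · intro r θ
      refine (hd _).comp_hasDerivAt θ ?_
      simpa using (((Complex.ofRealCLM.hasDerivAt (x := θ)).mul_const Complex.I).cexp).const_mul (r : ℂ)
    · intro y; fun_prop
    · intro x; fun_prop
    · exact hm.comp (by fun_prop)
    · intro x _ y _
      gcongr
      exact enorm_fderiv_apply_le _ _ (by simp [Complex.norm_exp_ofReal_mul_I])
    · intro x hx y _
      gcongr
      refine enorm_fderiv_apply_le _ _ ?_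
      simp only [norm_mul, Complex.norm_exp_ofReal_mul_I, Complex.norm_I, Complex.norm_real, mul_one]
      rw [Real.norm_of_nonneg (hρ0.trans hx.1.le)]
      exact hx.2.le.trans hρ1
  have hone : ∀ r ∈ Ioo (ρ / 2) ρ, ENNReal.ofReal r ≤ 1 := fun r hr =>
    ENNReal.ofReal_le_one.2 (hr.2.le.trans hρ1)
  refine le_trans ?_ (key.trans ?_)
  · exact setLIntegral_mono' measurableSet_Ioo fun r hr => lintegral_mono fun θ =>
      mul_le_of_le_one_left' (hone r hr)
  · gcongr
    rw [← lintegral_const_mul' _ _ (by norm_num)]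
    refine setLIntegral_mono' measurableSet_Ioo fun r hr => ?_
    rw [← lintegral_const_mul' _ _ (by norm_num)]
    refine lintegral_mono fun θ => ?_
    rw [← mul_assoc, mul_comm 4 (ENNReal.ofReal r)]
    exact le_mul_of_one_le_left' (one_le_ofReal_mul_four (by linarith [hr.1]))

/-- The factor 3/5 lies between 1/2 and 1/√2, so the square covers the hole of the annulus and still
fits inside the disc. -/
theorem ball_subset_annulus_union_square {ρ : ℝ} :
    Metric.ball (0 : ℂ) ρ ⊆ {z : ℂ | ‖z‖ ∈ Ioo (ρ / 2) ρ} ∪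
      Ioo (-(3 / 5 * ρ)) (3 / 5 * ρ) ×ℂ Ioo (-(3 / 5 * ρ)) (3 / 5 * ρ) := by
  intro z hz
  rw [mem_ball_zero_iff] at hz
  by_cases h : ρ / 2 < ‖z‖
  · exact Or.inl ⟨h, hz⟩
  · have hρ : 0 < ρ := (norm_nonneg z).trans_lt hz
    refine Or.inr ⟨abs_lt.1 ((Complex.abs_re_le_norm z).trans_lt ?_),
      abs_lt.1 ((Complex.abs_im_le_norm z).trans_lt ?_)⟩ <;> linarith

theorem square_subset_ball {ρ : ℝ} (hρ : 0 < ρ) :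
    Ioo (-(3 / 5 * ρ)) (3 / 5 * ρ) ×ℂ Ioo (-(3 / 5 * ρ)) (3 / 5 * ρ) ⊆ Metric.ball (0 : ℂ) ρ := by
  rintro z ⟨h1, h2⟩
  have h1 := sq_lt_sq' h1.1 h1.2
  have h2 := sq_lt_sq' h2.1 h2.2
  rw [mem_ball_zero_iff]
  refine lt_of_pow_lt_pow_left₀ 2 hρ.le ?_
  rw [← Complex.normSq_eq_norm_sq, Complex.normSq_apply]
  nlinarith

/-- The Gagliardo inequality on discs for functions without boundary conditions. -/
theorem rpow_lintegral_sq_ball_le (hu : ContDiff ℝ 1 u) {ρ : ℝ} (hρ : 1 / 2 ≤ ρ) (hρ1 : ρ ≤ 1) :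
    (∫⁻ z in Metric.ball 0 ρ, ‖u z‖ₑ ^ (2 : ℝ)) ^ (1 / 2 : ℝ) ≤
      20 * ∫⁻ z in Metric.ball 0 ρ, (‖u z‖ₑ + ‖fderiv ℝ u z‖ₑ) := by
  set A := {z : ℂ | ‖z‖ ∈ Ioo (ρ / 2) ρ}
  set Q := Ioo (-(3 / 5 * ρ)) (3 / 5 * ρ) ×ℂ Ioo (-(3 / 5 * ρ)) (3 / 5 * ρ)
  set M := ∫⁻ z in Metric.ball 0 ρ, (‖u z‖ₑ + ‖fderiv ℝ u z‖ₑ)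
  have hM : ∫⁻ z in Metric.ball 0 ρ, (4 * ‖u z‖ₑ + ‖fderiv ℝ u z‖ₑ) ≤ 4 * M := by
    rw [← lintegral_const_mul' _ _ (by norm_num)]
    refine lintegral_mono fun z => ?_
    rw [mul_add]
    gcongr
    exact le_mul_of_one_le_left' (by norm_num)
  have hA : A ⊆ Metric.ball 0 ρ := fun z hz => mem_ball_zero_iff.2 hz.2
  have hQ : Q ⊆ Metric.ball 0 ρ := square_subset_ball (by linarith)
  have h : ∫⁻ z in Metric.ball 0 ρ, ‖u z‖ₑ ^ (2 : ℝ) ≤ (20 * M) ^ (2 : ℝ) := by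
    calc ∫⁻ z in Metric.ball 0 ρ, ‖u z‖ₑ ^ (2 : ℝ)
        ≤ (∫⁻ z in A, ‖u z‖ₑ ^ (2 : ℝ)) + ∫⁻ z in Q, ‖u z‖ₑ ^ (2 : ℝ) :=
          (lintegral_mono_set ball_subset_annulus_union_square).trans (lintegral_union_le _ _ _)
      _ ≤ (4 * (4 * M)) ^ 2 + (4 * M) ^ 2 := by
          gcongr
          · exact (setLIntegral_sq_annulus_le hu hρ hρ1).trans
              (by gcongr; exact (lintegral_mono_set hA).trans hM)
          · exact (setLIntegral_sq_square_le hu (by linarith)).trans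
              (by gcongr; exact (lintegral_mono_set hQ).trans hM)
      _ = 272 * M ^ 2 := by ring
      _ ≤ 400 * M ^ 2 := by gcongr; norm_num
      _ = (20 * M) ^ (2 : ℝ) := by rw [ENNReal.rpow_two]; ring
  calc _ ≤ ((20 * M) ^ (2 : ℝ)) ^ (1 / 2 : ℝ) := by gcongr
    _ = _ := by rw [← ENNReal.rpow_mul]; norm_num

/-- The Sobolev inequality on discs at the critical exponent. -/
theorem rpow_lintegral_sobolev_ball_le (hu : ContDiff ℝ 1 u) {ρ : ℝ} (hρ : 1 / 2 ≤ ρ) (hρ1 : ρ ≤ 1)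
    {q s : ℝ} (hq : q ∈ Ioo 1 2) (hs : s = 2 * q / (2 - q)) :
    (∫⁻ z in Metric.ball 0 ρ, ‖u z‖ₑ ^ s) ^ (1 / s) ≤
      20 * (∫⁻ z in Metric.ball 0 ρ, (‖u z‖ₑ + ENNReal.ofReal (s / 2) * ‖fderiv ℝ u z‖ₑ) ^ q) ^ (1 / q) := by
  obtain ⟨hq1, hq2⟩ := hq
  have h2q : 0 < 2 - q := by linarith
  have hq0 : 0 < q := by linarith
  have hs0 : 0 < s := by rw [hs]; positivity
  have hγ : 1 < s / 2 := by
    rw [hs, mul_div_assoc, mul_div_cancel_left₀ _ two_ne_zero, lt_div_iff₀ h2q]; linarith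
  have hc := hu.continuous
  have hc' := hu.continuous_fderiv one_ne_zero
  set S := ∫⁻ z in Metric.ball 0 ρ, ‖u z‖ₑ ^ s with hS
  set T := ∫⁻ z in Metric.ball 0 ρ, (‖u z‖ₑ + ENNReal.ofReal (s / 2) * ‖fderiv ℝ u z‖ₑ) ^ q with hT
  -- Finiteness of S permits the cancellation of a power of S at the end.
  have hStop : S ≠ ⊤ := by
    obtain ⟨C, hC⟩ := (isCompact_closedBall (0 : ℂ) ρ).exists_bound_of_continuousOn hc.continuousOn
    refine (setLIntegral_lt_top_of_le_nnreal (measure_ball_lt_top).ne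
      ⟨(C.toNNReal) ^ s, fun z hz => ?_⟩).ne
    rw [ENNReal.coe_rpow_of_nonneg _ hs0.le]
    refine ENNReal.rpow_le_rpow ?_ hs0.le
    rw [← ofReal_norm]
    exact ENNReal.ofReal_le_ofReal (hC z (Metric.ball_subset_closedBall hz))
  -- The L² bound is applied to |u|^(s/2), whose square is |u|^s and which is C¹ because s/2 > 1.
  have h1 := rpow_lintegral_sq_ball_le (hu.norm_rpow hγ) hρ hρ1
  have e1 : ∫⁻ z in Metric.ball 0 ρ, ‖(‖u z‖ ^ (s / 2) : ℝ)‖ₑ ^ (2 : ℝ) = S := by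
    refine lintegral_congr fun z => ?_
    rw [Real.enorm_rpow_of_nonneg (norm_nonneg _) (by linarith), enorm_norm, ← ENNReal.rpow_mul]
    congr 1; ring
  have e2 : ∫⁻ z in Metric.ball 0 ρ, (‖(‖u z‖ ^ (s / 2) : ℝ)‖ₑ + ‖fderiv ℝ (fun x => ‖u x‖ ^ (s / 2)) z‖ₑ)
      ≤ ∫⁻ z in Metric.ball 0 ρ, ‖u z‖ₑ ^ (s / 2 - 1) *
        (‖u z‖ₑ + ENNReal.ofReal (s / 2) * ‖fderiv ℝ u z‖ₑ) := by
    refine lintegral_mono fun z => ?_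
    rw [mul_add, Real.enorm_rpow_of_nonneg (norm_nonneg _) (by linarith), enorm_norm]
    refine add_le_add (le_of_eq ?_) ?_
    · conv_rhs => rw [← ENNReal.rpow_one ‖u z‖ₑ, ← ENNReal.rpow_mul, one_mul]
      rw [← ENNReal.rpow_add_of_nonneg _ _ (by linarith) zero_le_one]
      congr 1; ring
    · have h := norm_fderiv_norm_rpow_le (hu.differentiable one_ne_zero) (x := z) hγ
      rw [← ofReal_norm]
      refine (ENNReal.ofReal_le_ofReal h).trans (le_of_eq ?_)
      rw [ENNReal.ofReal_mul (by positivity), ENNReal.ofReal_mul (by positivity),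
        ← ENNReal.ofReal_rpow_of_nonneg (norm_nonneg _) (by linarith), ofReal_norm, ofReal_norm]
      ring
  have hHol : (q / (q - 1)).HolderConjugate q := (Real.HolderConjugate.conjExponent hq1).symm
  have e3 := ENNReal.lintegral_mul_le_Lp_mul_Lq (volume.restrict (Metric.ball (0 : ℂ) ρ)) hHol
    (f := fun z => ‖u z‖ₑ ^ (s / 2 - 1))
    (g := fun z => ‖u z‖ₑ + ENNReal.ofReal (s / 2) * ‖fderiv ℝ u z‖ₑ)
    (by fun_prop) (by fun_prop)
  simp only [Pi.mul_apply] at e3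
  -- The exponents fit: (s/2 - 1)·q/(q - 1) = s.
  have e4 : ∫⁻ z in Metric.ball 0 ρ, (‖u z‖ₑ ^ (s / 2 - 1)) ^ (q / (q - 1)) = S := by
    refine lintegral_congr fun z => ?_
    rw [← ENNReal.rpow_mul]
    congr 1
    have : q - 1 ≠ 0 := by linarith
    rw [hs]; field_simp; ring
  rw [e4] at e3
  have h2 : S ^ (1 / 2 : ℝ) ≤ 20 * (S ^ (1 / (q / (q - 1))) * T ^ (1 / q)) := by
    rw [e1] at h1
    exact h1.trans (by gcongr; exact e2.trans e3)
  rcases eq_or_ne S 0 with h0 | h0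
  · rw [h0, ENNReal.zero_rpow_of_pos (by positivity)]; exact zero_le
  -- Since 1/2 - (q - 1)/q = 1/s, dividing by the power of S on the right leaves S^(1/s).
  · have e5 : S ^ (1 / 2 : ℝ) = S ^ (1 / (q / (q - 1))) * S ^ (1 / s) := by
      rw [← ENNReal.rpow_add _ _ h0 hStop]
      congr 1
      rw [hs]; field_simp; ring
    have hne0 : S ^ (1 / (q / (q - 1))) ≠ 0 := by
      simp [ENNReal.rpow_eq_zero_iff, h0, hStop]
    have hnet : S ^ (1 / (q / (q - 1))) ≠ ⊤ :=
      ENNReal.rpow_ne_top_of_nonneg (by have : 0 < q - 1 := by linarith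
                                        positivity) hStop
    rw [e5, mul_left_comm] at h2
    exact (ENNReal.mul_le_mul_iff_right hne0 hnet).1 h2

end Gagliardo

/-! ### Poincaré's inequality for smooth functions on discs -/

theorem lintegral_rpow_le_lintegral_rpow {α : Type*} [MeasurableSpace α] {μ : Measure α}
    [IsProbabilityMeasure μ] {g : α → ℝ≥0∞} (hg : AEMeasurable g μ) {q : ℝ} (hq : 1 ≤ q) :
    (∫⁻ x, g x ∂μ) ^ q ≤ ∫⁻ x, g x ^ q ∂μ := by
  have h := eLpNorm'_le_eLpNorm'_of_exponent_le zero_lt_one hq μ hg.aestronglyMeasurable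
  have hq0 : 0 < q := by linarith
  have h2 := ENNReal.rpow_le_rpow h hq0.le
  simpa [eLpNorm', ← ENNReal.rpow_mul, inv_mul_cancel₀ hq0.ne'] using h2

theorem Complex.lintegral_comp_add_smul {F : ℂ → ℝ≥0∞} (hF : Measurable F) {a : ℝ} (ha : a ≠ 0)
    (b : ℂ) : ∫⁻ x, F (b + a • x) = ENNReal.ofReal (|(a ^ 2)⁻¹|) * ∫⁻ x, F x := by
  have h1 : ∫⁻ x, F (b + a • x) = ∫⁻ y, F (b + y) ∂(Measure.map (a • ·) volume) :=
    (lintegral_map (hF.comp (measurable_const_add b)) (measurable_const_smul a)).symm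
  rw [h1, Measure.map_addHaar_smul volume ha, lintegral_smul_measure, lintegral_add_left_eq_self,
    Complex.finrank_real_complex, smul_eq_mul]

theorem Complex.lintegral_comp_add_smul_le {F : ℂ → ℝ≥0∞} (hF : Measurable F) {a : ℝ}
    (ha : 1 / 2 ≤ a) (b : ℂ) : ∫⁻ x, F (b + a • x) ≤ 4 * ∫⁻ x, F x := by
  rw [Complex.lintegral_comp_add_smul hF (by linarith)]
  gcongr
  rw [abs_of_nonneg (by positivity)]
  calc ENNReal.ofReal (a ^ 2)⁻¹ ≤ ENNReal.ofReal 4 := ENNReal.ofReal_le_ofReal (by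
        rw [inv_le_comm₀ (by positivity) (by norm_num)]; nlinarith)
    _ = 4 := by norm_num

/-- One of t and 1 - t is at least 1/2. Substituting in the variable with that coefficient costs a
Jacobian of at most 4, so the bound is uniform in t. -/
theorem lintegral_lintegral_segment_le {F : ℂ → ℝ≥0∞} (hF : Measurable F) (B : Set ℂ) (t : ℝ) :
    ∫⁻ x in B, ∫⁻ y in B, F ((1 - t) • x + t • y) ≤ 4 * volume B * ∫⁻ z, F z := by
  have key : ∀ a b : ℝ, 1 / 2 ≤ b →
      ∫⁻ x in B, ∫⁻ y in B, F (a • x + b • y) ≤ 4 * volume B * ∫⁻ z, F z := by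
    intro a b hb
    calc ∫⁻ x in B, ∫⁻ y in B, F (a • x + b • y) ≤ ∫⁻ _ in B, 4 * ∫⁻ z, F z :=
          lintegral_mono fun x => (setLIntegral_le_lintegral _ _).trans
            (Complex.lintegral_comp_add_smul_le hF hb (a • x))
      _ = _ := by rw [setLIntegral_const]; ring
  rcases le_total (1 / 2) t with h | h
  · exact key _ _ h
  · rw [lintegral_lintegral_swap (by
      refine Measurable.aemeasurable ?_
      exact hF.comp (by fun_prop))]
    simp_rw [add_comm ((1 - t) • _)]
    exact key t (1 - t) (by linarith)

theorem enorm_sub_rpow_le_lintegral_segment {u : ℂ → ℝ} (hu : ContDiff ℝ 1 u) {q : ℝ} (hq : 1 ≤ q)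
    {x y : ℂ} (hxy : ‖y - x‖ ≤ 2) :
    ‖u x - u y‖ₑ ^ q ≤ 2 ^ q * ∫⁻ t in Ioo (0 : ℝ) 1, ‖fderiv ℝ u ((1 - t) • x + t • y)‖ₑ ^ q := by
  have hq0 : 0 ≤ q := by linarith
  have hc' := hu.continuous_fderiv one_ne_zero
  have hw : ∀ t : ℝ, HasDerivAt (fun t : ℝ => u ((1 - t) • x + t • y))
      (fderiv ℝ u ((1 - t) • x + t • y) (y - x)) t := by
    intro t
    refine ((hu.differentiable one_ne_zero _).hasFDerivAt).comp_hasDerivAt t ?_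
    exact ((((hasDerivAt_id t).const_sub 1).smul_const x).add
      ((hasDerivAt_id t).smul_const y)).congr_deriv (by module)
  have h1 := enorm_sub_le_lintegral_enorm_deriv hw (by fun_prop)
    (show (0 : ℝ) ∈ Icc (0 : ℝ) 1 by simp) (show (1 : ℝ) ∈ Icc (0 : ℝ) 1 by simp)
  simp only [sub_zero, one_smul, zero_smul, add_zero, sub_self, zero_add] at h1
  have h2 : ∫⁻ t in Ioo (0 : ℝ) 1, ‖fderiv ℝ u ((1 - t) • x + t • y) (y - x)‖ₑ
      ≤ 2 * ∫⁻ t in Ioo (0 : ℝ) 1, ‖fderiv ℝ u ((1 - t) • x + t • y)‖ₑ := by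
    rw [← lintegral_const_mul' _ _ (by norm_num)]
    refine lintegral_mono fun t => ?_
    refine ((fderiv ℝ u _).le_opENorm _).trans ?_
    rw [mul_comm]
    gcongr
    rw [← ofReal_norm]
    exact (ENNReal.ofReal_le_ofReal hxy).trans (by norm_num)
  have : IsProbabilityMeasure (volume.restrict (Ioo (0 : ℝ) 1)) := ⟨by simp⟩
  calc ‖u x - u y‖ₑ ^ q
      ≤ (2 * ∫⁻ t in Ioo (0 : ℝ) 1, ‖fderiv ℝ u ((1 - t) • x + t • y)‖ₑ) ^ q := by
        gcongr; exact h1.trans h2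
    _ = 2 ^ q * (∫⁻ t in Ioo (0 : ℝ) 1, ‖fderiv ℝ u ((1 - t) • x + t • y)‖ₑ) ^ q :=
        ENNReal.mul_rpow_of_nonneg _ _ hq0
    _ ≤ _ := by
        gcongr
        exact lintegral_rpow_le_lintegral_rpow (by fun_prop) hq

/-- The Poincaré inequality on discs, in the form of a double integral. -/
theorem lintegral_lintegral_enorm_sub_rpow_ball_le {u : ℂ → ℝ} (hu : ContDiff ℝ 1 u) {q : ℝ}
    (hq : 1 ≤ q) {ρ : ℝ} (hρ : ρ ≤ 1) :
    ∫⁻ x in Metric.ball 0 ρ, ∫⁻ y in Metric.ball 0 ρ, ‖u x - u y‖ₑ ^ q ≤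
      2 ^ q * (4 * volume unitDisc) * ∫⁻ z in Metric.ball 0 ρ, ‖fderiv ℝ u z‖ₑ ^ q := by
  have hc' := hu.continuous_fderiv one_ne_zero
  set B := Metric.ball (0 : ℂ) ρ
  set F := B.indicator fun z => ‖fderiv ℝ u z‖ₑ ^ q with hFdef
  have hBm : MeasurableSet B := measurableSet_ball
  have hF : Measurable F := Measurable.indicator (by fun_prop) hBm
  have hBD : B ⊆ unitDisc := Metric.ball_subset_ball hρ
  calc ∫⁻ x in B, ∫⁻ y in B, ‖u x - u y‖ₑ ^ q
      ≤ ∫⁻ x in B, ∫⁻ y in B, 2 ^ q * ∫⁻ t in Ioo (0 : ℝ) 1, F ((1 - t) • x + t • y) := by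
        refine setLIntegral_mono' hBm fun x hx => setLIntegral_mono' hBm fun y hy => ?_
        refine (enorm_sub_rpow_le_lintegral_segment hu hq ?_).trans (le_of_eq ?_)
        · have h1 := mem_ball_zero_iff.1 hx
          have h2 := mem_ball_zero_iff.1 hy
          linarith [norm_sub_le y x]
        · congr 1
          refine setLIntegral_congr_fun measurableSet_Ioo fun t ht => ?_
          rw [hFdef, indicator_of_mem]
          exact convex_ball (0 : ℂ) ρ hx hy (by linarith [ht.2]) ht.1.le (by ring)
    _ = 2 ^ q * ∫⁻ t in Ioo (0 : ℝ) 1, ∫⁻ x in B, ∫⁻ y in B, F ((1 - t) • x + t • y) := by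
        have hq' : (2 : ℝ≥0∞) ^ q ≠ ⊤ := ENNReal.rpow_ne_top_of_nonneg (by linarith) (by norm_num)
        simp_rw [lintegral_const_mul' _ _ hq']
        congr 1
        have m3 : Measurable fun p : (ℂ × ℝ) × ℂ => F ((1 - p.1.2) • p.1.1 + p.1.2 • p.2) :=
          hF.comp (by fun_prop)
        rw [← lintegral_lintegral_swap (f := fun x t => ∫⁻ y in B, F ((1 - t) • x + t • y))
          m3.lintegral_prod_right'.aemeasurable]
        refine lintegral_congr fun x => ?_
        refine lintegral_lintegral_swap ?_
        refine Measurable.aemeasurable ?_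
        exact hF.comp (by fun_prop)
    _ ≤ 2 ^ q * ∫⁻ t in Ioo (0 : ℝ) 1, 4 * volume unitDisc * ∫⁻ z, F z := by
        gcongr
        refine (lintegral_lintegral_segment_le hF B _).trans ?_
        gcongr
    _ = _ := by
        rw [setLIntegral_const, Real.volume_Ioo, hFdef, lintegral_indicator hBm]
        simp only [sub_zero, ENNReal.ofReal_one, mul_one, mul_assoc]

/-! ### Mollification of weakly differentiable functions -/

section Mollification

open scoped Convolution
open ContinuousLinearMap (lsmul)

/-- The convolution of a function with a normalized bump function. -/
noncomputable def mollify (k : ContDiffBump (0 : ℂ)) (w : ℂ → ℝ) : ℂ → ℝ :=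
  k.normed volume ⋆[lsmul ℝ ℝ, volume] w

variable (k : ContDiffBump (0 : ℂ)) {w : ℂ → ℝ}

theorem contDiff_mollify (hw : LocallyIntegrable w) : ContDiff ℝ 1 (mollify k w) :=
  k.hasCompactSupport_normed.contDiff_convolution_left (n := 1) _ k.contDiff_normed hw

theorem mollify_apply (w : ℂ → ℝ) (x : ℂ) :
    mollify k w x = ∫ t, k.normed volume (x - t) * w t := by
  rw [mollify, convolution_eq_swap]; rfl

theorem fderiv_mollify_apply (hw : LocallyIntegrable w) (x v : ℂ) :
    fderiv ℝ (mollify k w) x v = ∫ t, fderiv ℝ (k.normed volume) (x - t) v * w t := by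
  have hc : ContDiff ℝ 1 (k.normed (volume : Measure ℂ)) := k.contDiff_normed
  rw [mollify, (k.hasCompactSupport_normed.hasFDerivAt_convolution_left (lsmul ℝ ℝ) hc hw x).fderiv,
    convolution_eq_swap, ContinuousLinearMap.integral_apply]
  · rfl
  · exact ((k.hasCompactSupport_normed.fderiv ℝ).convolutionExists_left _
      (hc.continuous_fderiv one_ne_zero) hw x).integrable_swap

theorem lintegral_enorm_normed_sub (x : ℂ) : ∫⁻ t, ‖k.normed volume (x - t)‖ₑ = 1 := by
  rw [lintegral_sub_left_eq_self (fun t => ‖k.normed volume t‖ₑ) x,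
    ← ofReal_integral_norm_eq_lintegral_enorm k.integrable_normed]
  simp_rw [Real.norm_of_nonneg (k.nonneg_normed _)]
  rw [k.integral_normed, ENNReal.ofReal_one]

theorem lintegral_enorm_normed_sub' (t : ℂ) : ∫⁻ x, ‖k.normed volume (x - t)‖ₑ = 1 := by
  rw [lintegral_sub_right_eq_self (fun x => ‖k.normed volume x‖ₑ) t]
  simpa [k.normed_neg] using lintegral_enorm_normed_sub k 0

/-- Young's inequality for the convolution with a normalized bump function. -/
theorem lintegral_rpow_lintegral_normed_le {g : ℂ → ℝ≥0∞} (hg : AEMeasurable g) {q : ℝ} (hq : 1 ≤ q) :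
    ∫⁻ x, (∫⁻ t, ‖k.normed volume (x - t)‖ₑ * g t) ^ q ≤ ∫⁻ t, g t ^ q := by
  have hk : Continuous (k.normed (volume : Measure ℂ)) := k.continuous_normed
  have h1 : ∀ x, (∫⁻ t, ‖k.normed volume (x - t)‖ₑ * g t) ^ q ≤
      ∫⁻ t, ‖k.normed volume (x - t)‖ₑ * g t ^ q := by
    intro x
    have hm : AEMeasurable (fun t => ‖k.normed volume (x - t)‖ₑ) := by fun_prop
    -- The kernel is a probability density in t, so Jensen's inequality applies for each x.
    have : IsProbabilityMeasure (volume.withDensity fun t => ‖k.normed volume (x - t)‖ₑ) :=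
      ⟨by rw [withDensity_apply _ MeasurableSet.univ, Measure.restrict_univ,
        lintegral_enorm_normed_sub]⟩
    have hg' := hg.mono_ac (withDensity_absolutelyContinuous volume
      fun t => ‖k.normed volume (x - t)‖ₑ)
    have h := lintegral_rpow_le_lintegral_rpow hg' hq
    rwa [lintegral_withDensity_eq_lintegral_mul₀ hm hg,
      lintegral_withDensity_eq_lintegral_mul₀ hm (hg.pow_const q)] at h
  calc ∫⁻ x, (∫⁻ t, ‖k.normed volume (x - t)‖ₑ * g t) ^ q
      ≤ ∫⁻ x, ∫⁻ t, ‖k.normed volume (x - t)‖ₑ * g t ^ q := lintegral_mono h1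
    _ = ∫⁻ t, ∫⁻ x, ‖k.normed volume (x - t)‖ₑ * g t ^ q := by
        refine lintegral_lintegral_swap ?_
        refine AEMeasurable.mul ?_ ((hg.pow_const q).comp_quasiMeasurePreserving
          Measure.quasiMeasurePreserving_snd)
        refine Continuous.aemeasurable ?_
        fun_prop
    _ = ∫⁻ t, g t ^ q := by
        refine lintegral_congr fun t => ?_
        have hm : Measurable fun x => ‖k.normed volume (x - t)‖ₑ :=
          (hk.comp (continuous_sub_right t)).enorm.measurable
        rw [lintegral_mul_const _ hm, lintegral_enorm_normed_sub', one_mul]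

theorem enorm_mollify_le (w : ℂ → ℝ) (x : ℂ) :
    ‖mollify k w x‖ₑ ≤ ∫⁻ t, ‖k.normed volume (x - t)‖ₑ * ‖w t‖ₑ := by
  rw [mollify_apply]
  simpa only [enorm_mul] using
    enorm_integral_le_lintegral_enorm fun t => k.normed volume (x - t) * w t

theorem lintegral_enorm_mollify_rpow_le (hw : AEStronglyMeasurable w) {q : ℝ} (hq : 1 ≤ q) :
    ∫⁻ x, ‖mollify k w x‖ₑ ^ q ≤ ∫⁻ x, ‖w x‖ₑ ^ q :=
  (lintegral_mono fun x => ENNReal.rpow_le_rpow (enorm_mollify_le k w x) (by linarith)).trans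
    (lintegral_rpow_lintegral_normed_le k hw.enorm hq)

theorem tsupport_normed_sub_subset (x : ℂ) :
    tsupport (fun t => k.normed volume (x - t)) ⊆ Metric.closedBall x k.rOut := by
  refine closure_minimal (fun t ht => ?_) Metric.isClosed_closedBall
  have h : x - t ∈ Function.support (k.normed (volume : Measure ℂ)) := ht
  rw [k.support_normed_eq, mem_ball_zero_iff] at h
  rw [Metric.mem_closedBall, dist_comm, dist_eq_norm]
  exact h.le

/-- The mollification of a function with a weak gradient is controlled by that gradient. -/
theorem enorm_fderiv_mollify_le {Ω B : Set ℂ} {u : ℂ → ℝ} {H : ℂ → ℂ} (hu : HasWeakGradientOn Ω u H)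
    (hB : MeasurableSet B) (hBΩ : B ⊆ Ω) (hΩ : MeasurableSet Ω)
    (huB : IntegrableOn u B) {x : ℂ} (hx : Metric.closedBall x k.rOut ⊆ B) :
    ‖fderiv ℝ (mollify k (B.indicator u)) x‖ₑ ≤
      ∫⁻ t, ‖k.normed volume (x - t)‖ₑ * ‖B.indicator H t‖ₑ := by
  have hc : ContDiff ℝ ∞ (k.normed (volume : Measure ℂ)) := k.contDiff_normed
  have hwi : LocallyIntegrable (B.indicator u) := (huB.integrable_indicator hB).locallyIntegrable
  set η := fun t => k.normed volume (x - t) with hη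
  have hts : tsupport η ⊆ Metric.closedBall x k.rOut := tsupport_normed_sub_subset k x
  have hηc : HasCompactSupport η :=
    (isCompact_closedBall x k.rOut).of_isClosed_subset (isClosed_tsupport _) hts
  have hηd : ∀ t v, fderiv ℝ η t v = - fderiv ℝ (k.normed volume) (x - t) v := by
    intro t v
    have h1 := ((hc.differentiable (by simp)) (x - t)).hasFDerivAt.comp t
      ((hasFDerivAt_id (𝕜 := ℝ) t).const_sub x)
    have h2 : fderiv ℝ η t = _ := h1.fderiv
    rw [h2]
    simp
  -- The kernel t ↦ k(x - t) is itself an admissible test function. Its support lies in B, so the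
  -- truncation of u to B is not felt.
  have key : ∀ v, fderiv ℝ (mollify k (B.indicator u)) x v
      = ∫ t in Ω, inner ℝ (H t) v * η t := by
    intro v
    rw [fderiv_mollify_apply k hwi, ← neg_inj, ← hu.2.2 η (hc.comp (by fun_prop)) hηc
      (hts.trans (hx.trans hBΩ)) v, ← integral_neg, ← integral_indicator hΩ]
    refine integral_congr_ae (Filter.Eventually.of_forall fun t => ?_)
    simp only
    by_cases ht : t ∈ B
    · rw [indicator_of_mem ht, indicator_of_mem (hBΩ ht), hηd]; ring
    · rw [indicator_of_notMem ht]
      have h0 : fderiv ℝ η t = 0 := by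
        by_contra hne
        exact ht (hx (hts (support_fderiv_subset ℝ hne)))
      by_cases ht' : t ∈ Ω
      · rw [indicator_of_mem ht', h0]; simp
      · rw [indicator_of_notMem ht']; simp
  have hfin : ∀ v, ‖fderiv ℝ (mollify k (B.indicator u)) x v‖ₑ ≤
      (∫⁻ t, ‖k.normed volume (x - t)‖ₑ * ‖B.indicator H t‖ₑ) * ‖v‖ₑ := by
    intro v
    rw [key, ← lintegral_mul_const' _ _ enorm_ne_top]
    refine (enorm_integral_le_lintegral_enorm _).trans ?_
    rw [← lintegral_indicator hΩ]
    refine lintegral_mono fun t => ?_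
    by_cases ht : t ∈ B
    · rw [indicator_of_mem ht, indicator_of_mem (hBΩ ht), enorm_mul, mul_comm, mul_assoc]
      gcongr
      rw [← ofReal_norm, ← ofReal_norm, ← ofReal_norm, ← ENNReal.ofReal_mul (norm_nonneg _)]
      exact ENNReal.ofReal_le_ofReal (norm_inner_le_norm _ _)
    · have h0 : η t = 0 := by
        by_contra hne
        exact ht (hx (hts (subset_tsupport _ hne)))
      by_cases ht' : t ∈ Ω
      · rw [indicator_of_mem ht', h0]; simp
      · rw [indicator_of_notMem ht']; simp
  exact ContinuousLinearMap.opENorm_le_bound _ hfin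

end Mollification

open Filter Topology in
/-- Approximation by smooth functions on smaller discs. -/
theorem exists_seq_contDiff_tendsto {u : ℂ → ℝ} {H : ℂ → ℂ} (hu : HasWeakGradientOn unitDisc u H)
    {q : ℝ} (hq : 1 ≤ q) {ρ : ℝ} (hρ0 : 0 < ρ) (hρ : ρ < 1) :
    ∃ U : ℕ → ℂ → ℝ, (∀ n, ContDiff ℝ 1 (U n)) ∧
      (∀ n, ∫⁻ x in Metric.ball 0 ρ, ‖U n x‖ₑ ^ q ≤ ∫⁻ x in unitDisc, ‖u x‖ₑ ^ q) ∧
      (∀ n, ∫⁻ x in Metric.ball 0 ρ, ‖fderiv ℝ (U n) x‖ₑ ^ q ≤ ∫⁻ x in unitDisc, ‖H x‖ₑ ^ q) ∧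
      ∀ᵐ x ∂volume.restrict (Metric.ball 0 ρ), Tendsto (fun n => U n x) atTop (𝓝 (u x)) := by
  have hq0 : 0 < q := by linarith
  -- Up to the boundary u and H need not be known integrable; on this intermediate disc, relatively
  -- compact in the unit disc, they are.
  set B := Metric.ball (0 : ℂ) ((1 + ρ) / 2) with hBdef
  have hB : MeasurableSet B := measurableSet_ball
  have hD : MeasurableSet unitDisc := measurableSet_ball
  have hBD : B ⊆ unitDisc := Metric.ball_subset_ball (by linarith)
  have hcB : Metric.closedBall (0 : ℂ) ((1 + ρ) / 2) ⊆ unitDisc :=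
    Metric.closedBall_subset_ball (by linarith)
  have hloc : IsLocallyClosed unitDisc := Metric.isOpen_ball.isLocallyClosed
  have huB : IntegrableOn u B := ((locallyIntegrableOn_iff hloc).1 hu.1 _ hcB
    (isCompact_closedBall _ _)).mono_set Metric.ball_subset_closedBall
  have hHB : IntegrableOn H B := ((locallyIntegrableOn_iff hloc).1 hu.2.1 _ hcB
    (isCompact_closedBall _ _)).mono_set Metric.ball_subset_closedBall
  have hwi := huB.integrable_indicator hB
  have hHi := hHB.integrable_indicator hB
  -- Half the gap between the radii ρ and (1 + ρ)/2, so the mollifier centred at a point of the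
  -- small disc stays inside B.
  set δ := (1 - ρ) / 4 with hδ
  have hδ0 : 0 < δ := by rw [hδ]; linarith
  let k : ℕ → ContDiffBump (0 : ℂ) := fun n =>
    ⟨δ / (n + 1) / 2, δ / (n + 1), by positivity, half_lt_self (by positivity)⟩
  have hkδ : ∀ n, (k n).rOut ≤ δ := fun n => div_le_self hδ0.le (by
    have : (0 : ℝ) ≤ n := n.cast_nonneg
    linarith)
  have hind : ∀ {E : Type} [NormedAddCommGroup E] (f : ℂ → E),
      ∫⁻ x, ‖B.indicator f x‖ₑ ^ q ≤ ∫⁻ x in unitDisc, ‖f x‖ₑ ^ q := by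
    intro E _ f
    rw [← lintegral_indicator hD]
    refine lintegral_mono fun x => ?_
    by_cases hx : x ∈ B
    · rw [indicator_of_mem hx, indicator_of_mem (hBD hx)]
    · rw [indicator_of_notMem hx, enorm_zero, ENNReal.zero_rpow_of_pos hq0]; exact zero_le
  refine ⟨fun n => mollify (k n) (B.indicator u), fun n => contDiff_mollify _ hwi.locallyIntegrable,
    fun n => ?_, fun n => ?_, ?_⟩
  · exact (setLIntegral_le_lintegral _ _).trans
      ((lintegral_enorm_mollify_rpow_le _ hwi.aestronglyMeasurable hq).trans (hind u))
  · calc ∫⁻ x in Metric.ball 0 ρ, ‖fderiv ℝ (mollify (k n) (B.indicator u)) x‖ₑ ^ q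
        ≤ ∫⁻ x in Metric.ball 0 ρ,
          (∫⁻ t, ‖(k n).normed volume (x - t)‖ₑ * ‖B.indicator H t‖ₑ) ^ q := by
          refine setLIntegral_mono' measurableSet_ball fun x hx => ?_
          gcongr
          refine enorm_fderiv_mollify_le (k n) hu hB hBD hD huB ?_
          refine Metric.closedBall_subset_ball' ?_
          have := hkδ n
          have := Metric.mem_ball.1 hx
          linarith
      _ ≤ ∫⁻ x, (∫⁻ t, ‖(k n).normed volume (x - t)‖ₑ * ‖B.indicator H t‖ₑ) ^ q :=
          setLIntegral_le_lintegral _ _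
      _ ≤ ∫⁻ t, ‖B.indicator H t‖ₑ ^ q :=
          lintegral_rpow_lintegral_normed_le _ hHi.aestronglyMeasurable.enorm hq
      _ ≤ _ := hind H
  · have hlim : Tendsto (fun n => (k n).rOut) atTop (𝓝 0) :=
      tendsto_const_div_atTop_nhds_zero_nat δ |>.comp (tendsto_add_atTop_nat 1) |>.congr
        fun n => by simp [k]
    have h := ContDiffBump.ae_convolution_tendsto_right_of_locallyIntegrable (μ := volume) (K := 2)
      hlim (Eventually.of_forall fun n => by simp only [k]; linarith) hwi.locallyIntegrable
    rw [ae_restrict_iff' measurableSet_ball]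
    filter_upwards [h] with x hx hxρ
    have hxB : x ∈ B := Metric.ball_subset_ball (by linarith) hxρ
    rwa [indicator_of_mem hxB] at hx

/-! ### Poincaré and Sobolev inequalities on the unit disc -/

open Filter Topology in
theorem lintegral_le_of_ae_tendsto {α : Type*} [MeasurableSpace α] {μ : Measure α}
    {f : ℕ → α → ℝ≥0∞} {g : α → ℝ≥0∞} {M : ℝ≥0∞} (hf : ∀ n, AEMeasurable (f n) μ)
    (h : ∀ᵐ x ∂μ, Tendsto (fun n => f n x) atTop (𝓝 (g x))) (hM : ∀ n, ∫⁻ x, f n x ∂μ ≤ M) :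
    ∫⁻ x, g x ∂μ ≤ M := by
  calc ∫⁻ x, g x ∂μ ≤ ∫⁻ x, liminf (fun n => f n x) atTop ∂μ := by
        refine lintegral_mono_ae ?_
        filter_upwards [h] with x hx
        exact hx.liminf_eq.ge
    _ ≤ liminf (fun n => ∫⁻ x, f n x ∂μ) atTop := lintegral_liminf_le' hf
    _ ≤ M := by
        refine (liminf_le_liminf (Eventually.of_forall hM)).trans ?_
        simp

theorem exists_monotone_ball_exhaustion : ∃ ρ : ℕ → ℝ, Monotone ρ ∧ (∀ n, ρ n ∈ Ico (1 / 2) 1) ∧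
    ⋃ n, Metric.ball (0 : ℂ) (ρ n) = unitDisc := by
  refine ⟨fun n => 1 - 1 / (n + 2), fun m n h => ?_, fun n => ⟨?_, ?_⟩, ?_⟩
  · have : (m : ℝ) ≤ n := by exact_mod_cast h
    simp only
    gcongr
  · have : 1 / ((n : ℝ) + 2) ≤ 1 / 2 :=
      one_div_le_one_div_of_le two_pos (by linarith [(n.cast_nonneg : (0 : ℝ) ≤ n)])
    linarith
  · have : 0 < 1 / ((n : ℝ) + 2) := by positivity
    linarith
  · refine Subset.antisymm (iUnion_subset fun n => Metric.ball_subset_ball ?_) fun z hz => ?_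
    · have : 0 < 1 / ((n : ℝ) + 2) := by positivity
      linarith
    · rw [unitDisc, mem_ball_zero_iff] at hz
      obtain ⟨n, hn⟩ := exists_nat_one_div_lt (sub_pos.2 hz)
      refine mem_iUnion.2 ⟨n, mem_ball_zero_iff.2 ?_⟩
      have : 1 / ((n : ℝ) + 2) ≤ 1 / (n + 1) := one_div_le_one_div_of_le (by positivity) (by linarith)
      linarith

theorem setLIntegral_unitDisc_le {g : ℂ → ℝ≥0∞} {M : ℝ≥0∞}
    (h : ∀ ρ ∈ Ico (1 / 2 : ℝ) 1, ∫⁻ z in Metric.ball 0 ρ, g z ≤ M) : ∫⁻ z in unitDisc, g z ≤ M := by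
  obtain ⟨ρ, hmono, hρ, hU⟩ := exists_monotone_ball_exhaustion
  have hm : Monotone fun n => Metric.ball (0 : ℂ) (ρ n) := fun _ _ h => Metric.ball_subset_ball (hmono h)
  rw [← hU, setLIntegral_iUnion_of_directed _ hm.directed_le]
  exact iSup_le fun n => h _ (hρ n)

theorem setLIntegral_unitDisc_prod_le {g : ℂ × ℂ → ℝ≥0∞} {M : ℝ≥0∞}
    (h : ∀ ρ ∈ Ico (1 / 2 : ℝ) 1, ∫⁻ z in Metric.ball 0 ρ ×ˢ Metric.ball 0 ρ, g z ≤ M) :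
    ∫⁻ z in unitDisc ×ˢ unitDisc, g z ≤ M := by
  obtain ⟨ρ, hmono, hρ, hU⟩ := exists_monotone_ball_exhaustion
  have hm : Monotone fun n => Metric.ball (0 : ℂ) (ρ n) := fun _ _ h => Metric.ball_subset_ball (hmono h)
  rw [← hU, ← iUnion_prod_of_monotone hm hm, setLIntegral_iUnion_of_directed _
    (Monotone.directed_le fun _ _ h => prod_mono (hm h) (hm h))]
  exact iSup_le fun n => h _ (hρ n)

theorem isOpen_unitDisc : IsOpen unitDisc := Metric.isOpen_ball

theorem volume_unitDisc_ne_zero : volume unitDisc ≠ 0 :=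
  (Metric.measure_ball_pos volume (0 : ℂ) one_pos).ne'

theorem volume_unitDisc_ne_top : volume unitDisc ≠ ⊤ := measure_ball_lt_top.ne

section

variable {u : ℂ → ℝ} {H : ℂ → ℂ} {q : ℝ}

open Filter Topology in
theorem lintegral_prod_enorm_sub_rpow_unitDisc_le (hu : HasWeakGradientOn unitDisc u H) (hq : 1 ≤ q) :
    ∫⁻ p in unitDisc ×ˢ unitDisc, ‖u p.1 - u p.2‖ₑ ^ q ≤
      2 ^ q * (4 * volume unitDisc) * ∫⁻ z in unitDisc, ‖H z‖ₑ ^ q := by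
  refine setLIntegral_unitDisc_prod_le fun ρ hρ => ?_
  obtain ⟨U, hU, -, hUH, hlim⟩ := exists_seq_contDiff_tendsto hu hq (by linarith [hρ.1]) hρ.2
  have hc : ∀ n, Continuous fun p : ℂ × ℂ => ‖U n p.1 - U n p.2‖ₑ ^ q := fun n => by
    have := (hU n).continuous
    have : Continuous fun p : ℂ × ℂ => ‖U n p.1 - U n p.2‖ₑ := by fun_prop
    exact ENNReal.continuous_rpow_const.comp this
  refine lintegral_le_of_ae_tendsto (f := fun n p => ‖U n p.1 - U n p.2‖ₑ ^ q)
    (fun n => (hc n).aemeasurable) ?_ fun n => ?_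
  · rw [Measure.volume_eq_prod, ← Measure.prod_restrict]
    filter_upwards [Measure.quasiMeasurePreserving_fst.ae hlim,
      Measure.quasiMeasurePreserving_snd.ae hlim] with p h1 h2
    exact ((ENNReal.continuous_rpow_const.tendsto _).comp (h1.sub h2).enorm)
  · rw [Measure.volume_eq_prod, setLIntegral_prod _ (hc n).aemeasurable]
    exact (lintegral_lintegral_enorm_sub_rpow_ball_le (hU n) hq hρ.2.le).trans
      (mul_le_mul' le_rfl (hUH n))

/-- The Poincaré inequality on the unit disc. -/
theorem exists_lintegral_enorm_sub_const_rpow_unitDisc_le (hu : MemHomSobolev q unitDisc u H)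
    (hq : 1 ≤ q) :
    ∃ c : ℝ, ∫⁻ x in unitDisc, ‖u x - c‖ₑ ^ q ≤ 2 ^ q * 4 * ∫⁻ z in unitDisc, ‖H z‖ₑ ^ q := by
  have hq0 : 0 < q := by linarith
  have hum : AEMeasurable u (volume.restrict unitDisc) := hu.1.1.aestronglyMeasurable.aemeasurable
  set μ := (volume : Measure ℂ).restrict unitDisc
  have hm : AEMeasurable (fun p : ℂ × ℂ => ‖u p.1 - u p.2‖ₑ ^ q) (μ.prod μ) :=
    (((hum.comp_quasiMeasurePreserving Measure.quasiMeasurePreserving_fst).sub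
      (hum.comp_quasiMeasurePreserving Measure.quasiMeasurePreserving_snd)).enorm).pow_const q
  have h := lintegral_prod_enorm_sub_rpow_unitDisc_le hu.1 hq
  rw [Measure.volume_eq_prod, ← Measure.prod_restrict, lintegral_prod_symm _ hm] at h
  set I := ∫⁻ z in unitDisc, ‖H z‖ₑ ^ q
  have hm' : AEMeasurable (fun y => ∫⁻ x, ‖u x - u y‖ₑ ^ q ∂μ) μ :=
    hm.prod_swap.lintegral_prod_right'
  have hμ : μ ≠ 0 := by
    rw [Ne, Measure.restrict_eq_zero]; exact volume_unitDisc_ne_zero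
  have : IsFiniteMeasure μ := ⟨by simpa [μ] using volume_unitDisc_ne_top.lt_top⟩
  -- Some y makes the inner integral at most its average, and c = u(y) serves as the constant; the
  -- area of the disc cancels.
  obtain ⟨y, hy⟩ := exists_le_laverage hμ hm'
  refine ⟨u y, hy.trans ?_⟩
  rw [laverage_eq, Measure.restrict_apply_univ]
  refine ENNReal.div_le_of_le_mul (h.trans (le_of_eq ?_))
  ring

theorem exists_memLp_sub_const (hu : MemHomSobolev q unitDisc u H) (hq : 1 ≤ q) :
    ∃ c : ℝ, MemLp (fun z => u z - c) (ENNReal.ofReal q) (volume.restrict unitDisc) ∧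
      (∫⁻ x in unitDisc, ‖u x - c‖ₑ ^ q) ^ (1 / q) ≤ 8 * gradNorm q unitDisc H := by
  have hq0 : 0 < q := by linarith
  obtain ⟨c, hc⟩ := exists_lintegral_enorm_sub_const_rpow_unitDisc_le hu hq
  have hle : (∫⁻ x in unitDisc, ‖u x - c‖ₑ ^ q) ^ (1 / q) ≤ 8 * gradNorm q unitDisc H := by
    calc (∫⁻ x in unitDisc, ‖u x - c‖ₑ ^ q) ^ (1 / q)
        ≤ (2 ^ q * 4 * ∫⁻ z in unitDisc, ‖H z‖ₑ ^ q) ^ (1 / q) := by gcongr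
      -- Using 4 ≤ 4^q gives the constant 8 = 2·4, independent of q.
      _ ≤ (2 ^ q * 4 ^ q * ∫⁻ z in unitDisc, ‖H z‖ₑ ^ q) ^ (1 / q) := by
          gcongr
          exact ENNReal.le_rpow_self_of_one_le (by norm_num) hq
      _ = _ := by
          rw [← ENNReal.mul_rpow_of_nonneg _ _ hq0.le, ENNReal.mul_rpow_of_nonneg _ _ (by positivity),
            ← ENNReal.rpow_mul, mul_one_div_cancel hq0.ne', ENNReal.rpow_one, gradNorm]
          norm_num
  refine ⟨c, ⟨hu.1.1.aestronglyMeasurable.sub aestronglyMeasurable_const, ?_⟩, hle⟩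
  rw [eLpNorm_eq_lintegral_rpow_enorm_toReal (by simpa using hq0) ENNReal.ofReal_ne_top,
    ENNReal.toReal_ofReal hq0.le]
  refine hle.trans_lt (ENNReal.mul_lt_top (by norm_num) ?_)
  rw [← eLpNorm_eq_gradNorm hq0]
  exact hu.2.2

/-- A function on the disc with gradient in `L^q` belongs to `L^q`. -/
theorem MemHomSobolev.memSobolev_unitDisc (hu : MemHomSobolev q unitDisc u H) (hq : 1 ≤ q) :
    MemSobolev q unitDisc u H := by
  obtain ⟨c, hc, -⟩ := exists_memLp_sub_const hu hq
  have : IsFiniteMeasure ((volume : Measure ℂ).restrict unitDisc) :=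
    ⟨by simpa using volume_unitDisc_ne_top.lt_top⟩
  refine ⟨?_, hu⟩
  convert hc.add (memLp_const c) using 1
  ext z
  simp

open Filter Topology in
/-- The Sobolev inequality on the unit disc at the critical exponent. -/
theorem rpow_lintegral_sobolev_unitDisc_le (hu : HasWeakGradientOn unitDisc u H)
    {s : ℝ} (hq : q ∈ Ioo 1 2) (hs : s = 2 * q / (2 - q)) :
    (∫⁻ z in unitDisc, ‖u z‖ₑ ^ s) ^ (1 / s) ≤
      20 * ((∫⁻ z in unitDisc, ‖u z‖ₑ ^ q) ^ (1 / q) + ENNReal.ofReal (s / 2) * gradNorm q unitDisc H) := by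
  have hq1 : 1 ≤ q := hq.1.le
  have hq0 : 0 < q := by linarith
  have hs0 : 0 < s := by rw [hs]; have : 0 < 2 - q := by linarith [hq.2]
                         positivity
  set R := 20 * ((∫⁻ z in unitDisc, ‖u z‖ₑ ^ q) ^ (1 / q) + ENNReal.ofReal (s / 2) * gradNorm q unitDisc H)
  rw [one_div, ENNReal.rpow_inv_le_iff hs0]
  refine setLIntegral_unitDisc_le fun ρ hρ => ?_
  obtain ⟨U, hU, hUu, hUH, hlim⟩ := exists_seq_contDiff_tendsto hu hq1 (by linarith [hρ.1]) hρ.2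
  refine lintegral_le_of_ae_tendsto (f := fun n z => ‖U n z‖ₑ ^ s) (fun n => ?_) ?_ fun n => ?_
  · have := (hU n).continuous
    fun_prop
  · filter_upwards [hlim] with z hz
    exact (ENNReal.continuous_rpow_const.tendsto _).comp hz.enorm
  · rw [← ENNReal.rpow_inv_le_iff hs0, ← one_div]
    refine (rpow_lintegral_sobolev_ball_le (hU n) hρ.1 hρ.2.le hq hs).trans ?_
    have hc := (hU n).continuous
    have hc' := (hU n).continuous_fderiv one_ne_zero
    have hadd := ENNReal.lintegral_Lp_add_le (μ := volume.restrict (Metric.ball (0 : ℂ) ρ))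
      (f := fun z => ‖U n z‖ₑ) (g := fun z => ENNReal.ofReal (s / 2) * ‖fderiv ℝ (U n) z‖ₑ)
      (by fun_prop) (by fun_prop) hq1
    simp only [Pi.add_apply] at hadd
    refine mul_le_mul_right (hadd.trans (add_le_add ?_ ?_)) 20
    · gcongr ?_ ^ (1 / q)
      exact hUu n
    · simp_rw [ENNReal.mul_rpow_of_nonneg _ _ hq0.le]
      rw [lintegral_const_mul' _ _ (ENNReal.rpow_ne_top_of_nonneg hq0.le ENNReal.ofReal_ne_top),
        ENNReal.mul_rpow_of_nonneg _ _ (by positivity), ← ENNReal.rpow_mul,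
        mul_one_div_cancel hq0.ne', ENNReal.rpow_one, gradNorm]
      exact mul_le_mul' le_rfl (ENNReal.rpow_le_rpow (hUH n) (by positivity))

end

/-- A smooth function has its classical gradient as weak gradient. -/
theorem hasWeakGradientOn_of_contDiff {g : ℂ → ℝ} (hg : ContDiff ℝ ∞ g) (Ω : Set ℂ) :
    HasWeakGradientOn Ω g fun z => fderiv ℝ g z 1 + fderiv ℝ g z Complex.I * Complex.I := by
  have hc := hg.continuous
  have hc' := hg.continuous_fderiv (by simp)
  have hcG : Continuous fun z => (fderiv ℝ g z 1 + fderiv ℝ g z Complex.I * Complex.I : ℂ) := by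
    fun_prop
  refine ⟨hc.locallyIntegrable.locallyIntegrableOn _, hcG.locallyIntegrable.locallyIntegrableOn _, ?_⟩
  intro η hη hηc hηs v
  have hcη := hη.continuous
  have hcη' : Continuous fun z => fderiv ℝ η z v := (hη.continuous_fderiv (by simp)).clm_apply continuous_const
  have hinner : ∀ z, (inner ℝ (fderiv ℝ g z 1 + fderiv ℝ g z Complex.I * Complex.I : ℂ) v : ℝ)
      = fderiv ℝ g z v := by
    intro z
    have hv : v = v.re • (1 : ℂ) + v.im • Complex.I := by
      simp [Complex.re_add_im]
    conv_rhs => rw [hv, map_add, map_smul, map_smul]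
    simp [Complex.inner]
  simp_rw [hinner]
  rw [setIntegral_eq_integral_of_forall_compl_eq_zero, setIntegral_eq_integral_of_forall_compl_eq_zero]
  · refine integral_mul_fderiv_eq_neg_fderiv_mul_of_integrable ?_ ?_ ?_
      (fun x _ => hg.differentiable (by simp) x) (fun x _ => hη.differentiable (by simp) x)
    · exact ((hc'.clm_apply continuous_const).mul hcη).integrable_of_hasCompactSupport hηc.mul_left
    · exact (hc.mul hcη').integrable_of_hasCompactSupport (hηc.fderiv_apply ℝ v).mul_left
    · exact (hc.mul hcη).integrable_of_hasCompactSupport hηc.mul_left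
  · intro z hz
    rw [image_eq_zero_of_notMem_tsupport fun h => hz (hηs h), mul_zero]
  · intro z hz
    have : fderiv ℝ η z v = 0 := by
      by_contra hne
      exact hz (hηs (support_fderiv_subset ℝ fun h => hne (by rw [h]; rfl)))
    rw [this, mul_zero]

theorem HasWeakGradientOn.sub_const {Ω : Set ℂ} (hΩ : IsOpen Ω) {u : ℂ → ℝ} {H : ℂ → ℂ}
    (hu : HasWeakGradientOn Ω u H) (c : ℝ) : HasWeakGradientOn Ω (fun z => u z - c) H := by
  have hcl : LocallyIntegrableOn (fun _ : ℂ => c) Ω := locallyIntegrableOn_const c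
  refine ⟨hu.1.sub hcl, hu.2.1, fun η hη hηc hηs v => ?_⟩
  have hcη : Continuous fun z => fderiv ℝ η z v := (hη.continuous_fderiv (by simp)).clm_apply continuous_const
  have hts := (tsupport_fderiv_apply_subset ℝ v).trans hηs
  have hconst := hasWeakGradientOn_of_contDiff (contDiff_const (c := c)) Ω
  have h0 := hconst.2.2 η hη hηc hηs v
  simp only [fderiv_fun_const, Pi.zero_apply, zero_apply, Complex.ofReal_zero,
    zero_mul, add_zero, inner_zero_left, integral_zero, neg_zero] at h0
  simp_rw [sub_mul]
  rw [integral_sub (hu.1.integrableOn_mul_of_tsupport_subset hΩ hcη (hηc.fderiv_apply ℝ v) hts)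
    (hcl.integrableOn_mul_of_tsupport_subset hΩ hcη (hηc.fderiv_apply ℝ v) hts), h0, sub_zero]
  exact hu.2.2 η hη hηc hηs v

theorem gradNorm_lt_top {p : ℝ} (hp : 0 < p) {Ω : Set ℂ} {f : ℂ → ℝ} {G : ℂ → ℂ}
    (h : MemHomSobolev p Ω f G) : gradNorm p Ω G < ⊤ := by
  rw [← eLpNorm_eq_gradNorm hp]
  exact h.2.2

/-- The Poincaré–Sobolev inequality on the unit disc, including the critical exponent. -/
theorem poincareConst_unitDisc_lt_top {q r : ℝ} (hq : q ∈ Ioo 1 2) (hr : 1 ≤ r)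
    (hrq : r ≤ 2 * q / (2 - q)) : poincareConst r q unitDisc (fun _ => 1) < ⊤ := by
  set s := 2 * q / (2 - q) with hs
  have hr0 : 0 < r := by linarith
  have hs0 : 0 < s := hr0.trans_le hrq
  -- The Hölder factor for lowering the exponent from s to r on a set of finite measure.
  set A := volume unitDisc ^ (1 / r - 1 / s)
  have hA : A < ⊤ := (ENNReal.rpow_ne_top_of_nonneg
    (sub_nonneg.2 (one_div_le_one_div_of_le hr0 hrq)) volume_unitDisc_ne_top).lt_top
  refine lt_of_le_of_lt (b := 20 * (8 + ENNReal.ofReal (s / 2)) * A) (sInf_le fun f G hf => ?_)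
    (ENNReal.mul_lt_top (ENNReal.mul_lt_top (by norm_num) (by simp)) hA)
  obtain ⟨c, hc, hcle⟩ := exists_memLp_sub_const hf.2 hq.1.le
  have hS := rpow_lintegral_sobolev_unitDisc_le (hf.2.1.sub_const isOpen_unitDisc c) hq hs
  have hH := eLpNorm'_le_eLpNorm'_mul_rpow_measure_univ hr0 hrq hc.aestronglyMeasurable
  rw [Measure.restrict_apply_univ] at hH
  refine (iInf_le _ c).trans ?_
  simp only [ENNReal.ofReal_one, mul_one]
  calc (∫⁻ z in unitDisc, ‖f z - c‖ₑ ^ r) ^ (1 / r)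
      ≤ (∫⁻ z in unitDisc, ‖f z - c‖ₑ ^ s) ^ (1 / s) * A := hH
    _ ≤ (20 * (8 * gradNorm q unitDisc G + ENNReal.ofReal (s / 2) * gradNorm q unitDisc G)) * A := by
        gcongr
        exact hS.trans (by gcongr)
    _ = _ := by ring

/-! ### Positivity and attainment of the best constants -/

/-- Every c is at distance at least 1/2 from 1 or from 0, hence from u on all of A or all of B, both
of positive measure. -/
theorem infDistConst_ne_zero {r : ℝ} (hr : 0 < r) {Ω A B : Set ℂ} {u : ℂ → ℝ}
    (hA : IsOpen A) (hB : IsOpen B) (hAn : A.Nonempty) (hBn : B.Nonempty) (hAΩ : A ⊆ Ω) (hBΩ : B ⊆ Ω)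
    (huA : ∀ z ∈ A, u z = 1) (huB : ∀ z ∈ B, u z = 0) :
    infDistConst r Ω (fun _ => 1) u ≠ 0 := by
  set m := ((ENNReal.ofReal (1 / 2)) ^ r * min (volume A) (volume B)) ^ (1 / r)
  have hm : 0 < m := by
    refine ENNReal.rpow_pos_of_nonneg (ENNReal.mul_pos ?_ ?_) (by positivity)
    · exact (ENNReal.rpow_pos (by simp) (by simp)).ne'
    · exact (lt_min (hA.measure_pos _ hAn) (hB.measure_pos _ hBn)).ne'
  refine (hm.trans_le (le_iInf fun c => ?_)).ne'
  simp only [ENNReal.ofReal_one, mul_one]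
  have key : ∀ S : Set ℂ, MeasurableSet S → S ⊆ Ω → (∀ z ∈ S, 1 / 2 ≤ ‖u z - c‖) →
      ENNReal.ofReal (1 / 2) ^ r * volume S ≤ ∫⁻ z in Ω, ‖u z - c‖ₑ ^ r := by
    intro S hS hSΩ h
    rw [← setLIntegral_const]
    refine (setLIntegral_mono' hS fun z hz => ?_).trans (lintegral_mono_set hSΩ)
    gcongr
    rw [← ofReal_norm]
    exact ENNReal.ofReal_le_ofReal (h z hz)
  refine ENNReal.rpow_le_rpow ?_ (by positivity)
  rcases le_total c (1 / 2) with hc | hc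
  · refine le_trans (by gcongr; exact min_le_left _ _) (key A hA.measurableSet hAΩ fun z hz => ?_)
    rw [huA z hz, Real.norm_eq_abs]
    exact le_trans (by linarith) (le_abs_self _)
  · refine le_trans (by gcongr; exact min_le_right _ _) (key B hB.measurableSet hBΩ fun z hz => ?_)
    rw [huB z hz, Real.norm_eq_abs]
    exact le_trans (by linarith) (neg_le_abs _)

/-- Every non-empty open set carries a test function that is not constant. -/
theorem exists_nonconstant_test_function {Ω : Set ℂ} (hΩ : IsOpen Ω) (hne : Ω.Nonempty) :
    ∃ (f : ℂ → ℝ) (G : ℂ → ℂ) (A B : Set ℂ), (∀ p, MemSobolev p Ω f G) ∧ IsOpen A ∧ IsOpen B ∧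
      A.Nonempty ∧ B.Nonempty ∧ A ⊆ Ω ∧ B ⊆ Ω ∧ (∀ z ∈ A, f z = 1) ∧ ∀ z ∈ B, f z = 0 := by
  obtain ⟨z₀, hz₀⟩ := hne
  obtain ⟨R, hR, hball⟩ := Metric.isOpen_iff.1 hΩ z₀ hz₀
  let b : ContDiffBump z₀ := ⟨R / 4, R / 2, by positivity, by linarith⟩
  have hb : ContDiff ℝ ∞ b := b.contDiff
  have hc' := hb.continuous_fderiv (by simp)
  have hcs : HasCompactSupport b := b.hasCompactSupport
  refine ⟨b, _, Metric.ball z₀ (R / 4), Metric.ball z₀ R \ Metric.closedBall z₀ (R / 2),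
    fun p => ⟨?_, hasWeakGradientOn_of_contDiff hb Ω, ?_⟩, Metric.isOpen_ball,
    Metric.isOpen_ball.sdiff Metric.isClosed_closedBall, ⟨z₀, Metric.mem_ball_self (by positivity)⟩,
    ⟨z₀ + (3 / 4 * R : ℝ), ?_, ?_⟩, (Metric.ball_subset_ball (by linarith)).trans hball,
    sdiff_subset.trans hball, fun z hz => b.one_of_mem_closedBall (Metric.ball_subset_closedBall hz),
    fun z hz => b.zero_of_le_dist ?_⟩
  · exact (hb.continuous.memLp_of_hasCompactSupport hcs).restrict _
  · refine Continuous.memLp_of_hasCompactSupport (by fun_prop) ?_ |>.restrict _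
    refine HasCompactSupport.add ?_ ?_
    · exact (hcs.fderiv_apply ℝ 1).comp_left (g := ((↑) : ℝ → ℂ)) Complex.ofReal_zero
    · exact HasCompactSupport.mul_right
        ((hcs.fderiv_apply ℝ Complex.I).comp_left (g := ((↑) : ℝ → ℂ)) Complex.ofReal_zero)
  · rw [Metric.mem_ball, dist_eq_norm, add_sub_cancel_left, Complex.norm_real,
      Real.norm_of_nonneg (by positivity)]
    linarith
  · rw [Metric.mem_closedBall, dist_eq_norm, add_sub_cancel_left, Complex.norm_real,
      Real.norm_of_nonneg (by positivity)]
    linarith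
  · have h : ¬ dist z z₀ ≤ R / 2 := hz.2
    exact (not_le.1 h).le

/-- Excludes the product 0·∞ = 0 in the estimate of the weighted constant. -/
theorem poincareConst_ne_zero {r q : ℝ} (hr : 0 < r) (hq : 0 < q) {Ω : Set ℂ} (hΩ : IsOpen Ω)
    (hne : Ω.Nonempty) : poincareConst r q Ω (fun _ => 1) ≠ 0 := by
  obtain ⟨f, G, A, B, hf, hA, hB, hAn, hBn, hAΩ, hBΩ, h1, h0⟩ := exists_nonconstant_test_function hΩ hne
  have hm := infDistConst_ne_zero hr hA hB hAn hBn hAΩ hBΩ h1 h0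
  have hg := gradNorm_lt_top hq (hf q).2
  have hle : infDistConst r Ω (fun _ => 1) f / gradNorm q Ω G ≤ poincareConst r q Ω (fun _ => 1) :=
    le_sInf fun C hC => ENNReal.div_le_of_le_mul (hC f G (hf q))
  exact ((ENNReal.div_pos hm hg.ne).trans_le hle).ne'

/-- The infimum of admissible constants is itself admissible: multiplication by the finite number
‖G‖_p commutes with it. -/
theorem infDistConst_le_poincareConst_mul {r p : ℝ} (hp : 0 < p) {Ω : Set ℂ} {h : ℂ → ℝ}
    (hfin : poincareConst r p Ω h < ⊤) {f : ℂ → ℝ} {G : ℂ → ℂ} (hf : MemSobolev p Ω f G) :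
    infDistConst r Ω h f ≤ poincareConst r p Ω h * gradNorm p Ω G := by
  obtain ⟨C, hC, hCt⟩ := sInf_lt_iff.1 hfin
  have := ENNReal.le_iInf_mul_iInf (a := infDistConst r Ω h f)
    (f := fun C : {C : ℝ≥0∞ | ∀ (f : ℂ → ℝ) (G : ℂ → ℂ), MemSobolev p Ω f G →
      infDistConst r Ω h f ≤ C * gradNorm p Ω G} => (C : ℝ≥0∞))
    (g := fun _ : Unit => gradNorm p Ω G) ⟨⟨C, hC⟩, hCt.ne⟩
    ⟨(), (gradNorm_lt_top hp hf.2).ne⟩ fun C _ => C.2 f G hf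
  rwa [iInf_const, ← sInf_eq_iInf'] at this

/-! ### Transfer from the disc to Ω -/

section

variable {Ω : Set ℂ} {φ : ℂ → ℂ}

/-- A non-constant bump function has a non-constant composite. Poincaré's inequality on the disc
bounds the norm of any weak gradient of the composite from below, so uniqueness of weak gradients is
not needed. -/
theorem compositionNorm_invFunOn_ne_zero (hΩ : IsOpen Ω) (h : IsConformalHomeo Ω unitDisc φ)
    {p q : ℝ} (hp : 0 < p) (hq : 1 ≤ q) :
    compositionNorm p q Ω unitDisc (Function.invFunOn φ Ω) ≠ 0 := by
  have hne : Ω.Nonempty := by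
    obtain ⟨z, hz, -⟩ := h.2.surjOn (show (0 : ℂ) ∈ unitDisc from Metric.mem_ball_self one_pos)
    exact ⟨z, hz⟩
  obtain ⟨f, G, A, B, hf, hA, hB, hAn, hBn, hAΩ, hBΩ, h1, h0⟩ := exists_nonconstant_test_function hΩ hne
  have hval : ∀ S ⊆ Ω, ∀ c : ℝ, (∀ z ∈ S, f z = c) →
      ∀ w ∈ φ '' S, (f ∘ Function.invFunOn φ Ω) w = c := by
    rintro S hS c hc _ ⟨z, hz, rfl⟩
    rw [Function.comp_apply, h.2.injOn.leftInvOn_invFunOn (hS hz), hc z hz]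
  have hm := infDistConst_ne_zero (r := q) (by linarith)
    (isOpen_image_of_injOn hA (h.1.mono hAΩ) (h.2.injOn.mono hAΩ))
    (isOpen_image_of_injOn hB (h.1.mono hBΩ) (h.2.injOn.mono hBΩ)) (hAn.image φ) (hBn.image φ)
    ((image_mono hAΩ).trans h.2.image_eq.subset) ((image_mono hBΩ).trans h.2.image_eq.subset)
    (hval A hAΩ 1 h1) (hval B hBΩ 0 h0)
  have hg := gradNorm_lt_top hp (hf p).2
  set m := infDistConst q unitDisc (fun _ => 1) (f ∘ Function.invFunOn φ Ω)
  have hle : m / (8 * gradNorm p Ω G) ≤ compositionNorm p q Ω unitDisc (Function.invFunOn φ Ω) := by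
    refine le_sInf fun K hK => ENNReal.div_le_of_le_mul ?_
    obtain ⟨H, hH, hHle⟩ := hK.2 f G (hf p).2
    obtain ⟨c, -, hc⟩ := exists_memLp_sub_const hH hq
    calc m ≤ (∫⁻ x in unitDisc, ‖(f ∘ Function.invFunOn φ Ω) x - c‖ₑ ^ q) ^ (1 / q) := by
          refine (iInf_le _ c).trans (le_of_eq ?_)
          simp
      _ ≤ 8 * (K * gradNorm p Ω G) := hc.trans (by gcongr)
      _ = _ := by ring
  exact ((ENNReal.div_pos hm (ENNReal.mul_lt_top (by norm_num) hg).ne).trans_le hle).ne'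

/-- The composite f∘ψ is known only to have gradient in L^q; on the disc this already puts it in
W^{1,q}, so it is admissible for the unweighted inequality. -/
theorem poincareConst_conformalWeight_le (hΩ : IsOpen Ω) (h : IsConformalHomeo Ω unitDisc φ)
    {p q r : ℝ} (hp : 0 < p) (hq : 1 ≤ q) (hr : 0 < r) :
    poincareConst r p Ω (conformalWeight φ) ≤
      compositionNorm p q Ω unitDisc (Function.invFunOn φ Ω) *
        poincareConst r q unitDisc (fun _ => 1) := by
  have hK0 := compositionNorm_invFunOn_ne_zero hΩ h hp hq
  have hB0 : poincareConst r q unitDisc (fun _ => 1) ≠ 0 :=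
    poincareConst_ne_zero hr (by linarith) isOpen_unitDisc ⟨0, Metric.mem_ball_self one_pos⟩
  rcases eq_top_or_lt_top (compositionNorm p q Ω unitDisc (Function.invFunOn φ Ω)) with hK | hK
  · rw [hK, ENNReal.top_mul hB0]; exact le_top
  rcases eq_top_or_lt_top (poincareConst r q unitDisc (fun _ => 1)) with hB | hB
  · rw [hB, ENNReal.mul_top hK0]; exact le_top
  obtain ⟨K, hKm, hKt⟩ := sInf_lt_iff.1 hK
  obtain ⟨B, hBm, hBt⟩ := sInf_lt_iff.1 hB
  unfold compositionNorm
  conv_rhs => unfold poincareConst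
  rw [sInf_eq_iInf', sInf_eq_iInf']
  refine ENNReal.le_iInf_mul_iInf ⟨⟨K, hKm⟩, hKt.ne⟩ ⟨⟨B, hBm⟩, hBt.ne⟩ ?_
  rintro ⟨K, -, hK⟩ ⟨B, hB⟩
  refine sInf_le fun f G hf => ?_
  obtain ⟨H, hH, hHle⟩ := hK f G hf.2
  rw [← infDistConst_comp_invFunOn hΩ h]
  calc _ ≤ B * gradNorm q unitDisc H := hB _ _ (hH.memSobolev_unitDisc hq)
    _ ≤ B * (K * gradNorm p Ω G) := by gcongr
    _ = _ := by ring

end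

/-! ### The main theorem -/

theorem theoremC (Ω : Set ℂ) (hΩ_open : IsOpen Ω) (hΩ_sc : IsSimplyConnected Ω)
    (hΩ_bdry : (frontier Ω).Nonempty)
    (α₀ : ℝ) (hα₀ : α₀ ∈ Ioo (-2 : ℝ) 0) (hBrennan : BrennanConjectureOn α₀)
    (φ : ℂ → ℂ) (hφ : IsConformalHomeo Ω unitDisc φ)
    (p : ℝ) (hp : p ∈ Ioo ((|α₀| + 2) / (|α₀| + 1)) 2)
    (r : ℝ) (hr : r ∈ Icc 1 (2 * p / (2 - p) * (|α₀| / (2 + |α₀|)))) :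
    -- the inequality holds, with the best constant, which is finite
    poincareConst r p Ω (conformalWeight φ) < ⊤ ∧
    (∀ (f : ℂ → ℝ) (G : ℂ → ℂ), MemSobolev p Ω f G →
      infDistConst r Ω (conformalWeight φ) f ≤
        poincareConst r p Ω (conformalWeight φ) * gradNorm p Ω G) ∧
    -- the estimate of the best constant, with a finite right-hand side
    poincareConst r p Ω (conformalWeight φ) ≤
      ⨅ q ∈ Ico 1 (2 * p / (4 - p)),
        compositionNorm p q Ω unitDisc (Function.invFunOn φ Ω) *
          poincareConst r q unitDisc (fun _ => 1) ∧
    (⨅ q ∈ Ico 1 (2 * p / (4 - p)),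
        compositionNorm p q Ω unitDisc (Function.invFunOn φ Ω) *
          poincareConst r q unitDisc (fun _ => 1)) < ⊤ ∧
    -- the estimate of the norm of the composition operator
    (∀ q ∈ Ico 1 (2 * p / (4 - p)),
      compositionNorm p q Ω unitDisc (Function.invFunOn φ Ω) ≤
        (∫⁻ w in unitDisc, ‖deriv (Function.invFunOn φ Ω) w‖ₑ ^ ((p - 2) * q / (p - q))) ^
          ((p - q) / (p * q))) := by
  have hα : α₀ < 0 := hα₀.2
  rw [abs_of_neg hα] at hp hr
  obtain ⟨a, rfl⟩ : ∃ a, α₀ = -a := ⟨-α₀, by ring⟩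
  rw [neg_neg] at hp hr
  have ha0 : 0 < a := by linarith
  have ha2 : a < 2 := by linarith [hα₀.1]
  have hp2 : p < 2 := hp.2
  have hpa : a + 2 < p * (a + 1) := (div_lt_iff₀ (by linarith)).1 hp.1
  have hp1 : 1 < p := by nlinarith
  have hd : 0 < 2 - p + a := by linarith
  have h2p : 0 < 2 - p := by linarith
  have hq_lt : ∀ q ∈ Ico 1 (2 * p / (4 - p)), q < p := fun q hq =>
    hq.2.trans ((div_lt_iff₀ (by linarith)).2 (by nlinarith))
  have hK : ∀ q ∈ Ico 1 (2 * p / (4 - p)),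
      compositionNorm p q Ω unitDisc (Function.invFunOn φ Ω) ≤
        (∫⁻ w in unitDisc, ‖deriv (Function.invFunOn φ Ω) w‖ₑ ^ ((p - 2) * q / (p - q))) ^
          ((p - q) / (p * q)) := fun q hq =>
    compositionNorm_invFunOn_le hΩ_open isOpen_unitDisc hφ (by linarith [hq.1]) (hq_lt q hq)
  have hle : poincareConst r p Ω (conformalWeight φ) ≤
      ⨅ q ∈ Ico 1 (2 * p / (4 - p)),
        compositionNorm p q Ω unitDisc (Function.invFunOn φ Ω) *
          poincareConst r q unitDisc (fun _ => 1) :=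
    le_iInf₂ fun q hq => poincareConst_conformalWeight_le hΩ_open hφ (by linarith) hq.1
      (by linarith [hr.1])
  have hfin : (⨅ q ∈ Ico 1 (2 * p / (4 - p)),
        compositionNorm p q Ω unitDisc (Function.invFunOn φ Ω) *
          poincareConst r q unitDisc (fun _ => 1)) < ⊤ := by
    -- The solution of (p-2)q/(p-q) = -a. The lower bound on p is equivalent to q > 1, and a < 2
    -- gives q < 2p/(4-p).
    set q := a * p / (2 - p + a) with hqdef
    have hq1 : 1 < q := (lt_div_iff₀ hd).2 (by linarith)
    have hqlt : q < 2 * p / (4 - p) := by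
      rw [hqdef, div_lt_div_iff₀ hd (by linarith)]
      nlinarith [mul_pos (mul_pos h2p (sub_pos.2 ha2)) (by linarith : 0 < p)]
    have hq2 : q < 2 := hqlt.trans ((div_lt_iff₀ (by linarith)).2 (by linarith))
    have hqm : q ∈ Ico 1 (2 * p / (4 - p)) := ⟨hq1.le, hqlt⟩
    have hqp := hq_lt q hqm
    refine (iInf₂_le q hqm).trans_lt (ENNReal.mul_lt_top ((hK q hqm).trans_lt ?_) ?_)
    · have hexp : (p - 2) * q / (p - q) = -a := by
        rw [div_eq_iff (by linarith), hqdef]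
        field_simp
        ring
      rw [hexp]
      refine ENNReal.rpow_lt_top_of_nonneg ?_
        (hBrennan _ _ (hφ.invFunOn hΩ_open) (-a) ⟨le_rfl, by linarith⟩).ne
      exact div_nonneg (by linarith) (by positivity)
    -- For this q the critical exponent 2q/(2-q) equals the upper limit for r.
    · refine poincareConst_unitDisc_lt_top ⟨hq1, hq2⟩ hr.1 (hr.2.trans (le_of_eq ?_))
      have h2q : 2 - q = (2 - p) * (2 + a) / (2 - p + a) := by
        rw [hqdef]
        field_simp
        ring
      rw [h2q, hqdef]
      field_simp
  exact ⟨hle.trans_lt hfin, fun f G hf =>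
    infDistConst_le_poincareConst_mul (by linarith) (hle.trans_lt hfin) hf, hle, hfin, hK⟩
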